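/- Let $n\ge 1$, let $q>0$ be real, and let $\Theta=(\theta_{i,j})_{1\le i,j\le n}$ be complex numbers with $\theta_{i,i}=1$, $|\theta_{i,j}|=1$ and $\overline{\theta_{j,i}}=\theta_{i,j}$. Let $\mathcal{A}_{q,\Theta}(n)$ be the unital complex algebra generated by $V_{i,j}$ $(1\le i,j\le n)$ with the relations \begin{align*} V_{i,j}V_{i,l}&=q\theta_{l,j}V_{i,l}V_{i,j} && (j<l),\\ V_{i,j}V_{k,j}&=q\theta_{i,k}V_{k,j}V_{i,j} && (i<k),\\ \theta_{l,j}V_{i,l}V_{k,j}&=\theta_{i,k}V_{k,j}V_{i,l} && (i<k,\ j<l),\\ \theta_{j,l}V_{i,j}V_{k,l}-\theta_{i,k}V_{k,l}V_{i,j}&=(q-\tfrac1q)V_{i,l}V_{k,j} && (i<k,\ j<l), \end{align*} and put $$Det_q=\sum_{\sigma\in S_n}\Big(\prod_{x<y,\ \sigma(x)>\sigma(y)}(-q\,\theta_{\sigma(y),\sigma(x)})\Big)V_{\sigma(1),1}V_{\sigma(2),2}\cdots V_{\sigma(n),n}.$$ Let $\mathbb{C}[U_{q,\Theta}(n)]$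 be the unital complex algebra generated by the $V_{i,j}$ and a further element $\mathscr{D}^{-1}$, with the relations above together with $$Det_q\,\mathscr{D}^{-1}=\mathscr{D}^{-1}Det_q=1\quad\text{and}\quad V_{i,k}\mathscr{D}^{-1}=\Big(\prod_{a\ne k}\theta_{k,a}\Big)\Big(\prod_{a\neq i}\theta_{i,a}\Big)^{-1}\mathscr{D}^{-1}V_{i,k}\quad(1\le i,k\le n);$$ in it, $Det_q^{-1}$ means $\mathscr{D}^{-1}$. Order the generators by $V_{i,j}\le_0V_{k,l}$ if and only if $i+j<k+l$, or $i+j=k+l$ and $i\le k$. For a matrix of exponents $m=(m_{i,j})\in\mathbb{N}_0^{n\times n}$ and $1\le s\le 2n-1$ let $b_s(m)$ be the product of the powers $V_{i,j}^{m_{i,j}}$ over all $1\le i,j\le n$ with $i+j=s+1$, taken by increasing $i$. Let $M_0$ be the set of those $m$ with $\min_{1\le i\le n}m_{i,n+1-i}=0$. \textbf{Theorem (Basis).} \begin{enumerate} \item The ordered monomials $V_{i_1,j_1}^{r_1}\cdots V_{i_{n^2},j_{n^2}}^{r_{n^2}}$ with $r_1,\dots,r_{n^2}\ge0$, where $V_{i_1,j_1}\le_0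 V_{i_2,j_2}\le_0\cdots\le_0V_{i_{n^2},j_{n^2}}$ is the list of all generators in increasing order, form a basis of the vector space $\mathcal{A}_{q,\Theta}(n)$. \item The elements $b_1(m)b_2(m)\cdots b_{2n-1}(m)\,Det_q^{\,k}$ with $m\in M_0$ and $k\in\mathbb{Z}_{\ge 0}$ (the set $\hat B$) form a basis of $\mathcal{A}_{q,\Theta}(n)$. \item The elements $b_1(m)b_2(m)\cdots b_{2n-1}(m)\,Det_q^{\,k}$ with $m\in M_0$ and $k\in\mathbb{Z}$ (the set $\tilde B$) form a basis of $\mathbb{C}[U_{q,\Theta}(n)]$. \end{enumerate} In each case distinct exponents give distinct elements. -/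

import Mathlib

namespace QuantumUnitary

/-- The quantum determinant of a square array `V` of elements of a complex algebra:
`∑_σ (∏_{x < y, σ x > σ y} (-q θ_{σ y, σ x})) V_{σ 1, 1} V_{σ 2, 2} ⋯ V_{σ n, n}`. -/
noncomputable def qDet {n : ℕ} (q : ℝ) (θ : Matrix (Fin n) (Fin n) ℂ)
    {A : Type*} [Ring A] [Algebra ℂ A] (V : Fin n → Fin n → A) : A :=
  ∑ σ : Equiv.Perm (Fin n),
    (∏ p : Fin n × Fin n with p.1 < p.2 ∧ σ p.2 < σ p.1,
        (-(q : ℂ) * θ (σ p.2) (σ p.1))) •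
      (List.ofFn fun c : Fin n => V (σ c) c).prod

/-- The defining relations between the entries of the quantum matrix `V`. -/
inductive MatrixRel {n : ℕ} (q : ℝ) (θ : Matrix (Fin n) (Fin n) ℂ)
    {A : Type*} [Ring A] [Algebra ℂ A] (V : Fin n → Fin n → A) : A → A → Prop
  | row (i j l : Fin n) (hjl : j < l) :
      MatrixRel q θ V (V i j * V i l) (((q : ℂ) * θ l j) • (V i l * V i j))
  | col (i k j : Fin n) (hik : i < k) :
      MatrixRel q θ V (V i j * V k j) (((q : ℂ) * θ i k) • (V k j * V i j))
  | antidiag (i k j l : Fin n) (hik : i < k) (hjl : j < l) :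
      MatrixRel q θ V (θ l j • (V i l * V k j)) (θ i k • (V k j * V i l))
  | diag (i k j l : Fin n) (hik : i < k) (hjl : j < l) :
      MatrixRel q θ V (θ j l • (V i j * V k l) - θ i k • (V k l * V i j))
        (((q : ℂ) - 1 / (q : ℂ)) • (V i l * V k j))

/-- The free generators `V_{i,j}`. -/
noncomputable def freeV (n : ℕ) (i j : Fin n) : FreeAlgebra ℂ (Fin n × Fin n) :=
  FreeAlgebra.ι ℂ (i, j)

/-- The algebra `𝒜_{q,Θ}(n)`: generators `V_{i,j}` subject to `MatrixRel`. -/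
abbrev QMat (n : ℕ) (q : ℝ) (θ : Matrix (Fin n) (Fin n) ℂ) : Type :=
  RingQuot (MatrixRel q θ (freeV n))

/-- The generator `V_{i,j}` of `𝒜_{q,Θ}(n)`. -/
noncomputable def QMat.V {n : ℕ} (q : ℝ) (θ : Matrix (Fin n) (Fin n) ℂ) (i j : Fin n) :
    QMat n q θ :=
  RingQuot.mkAlgHom ℂ (MatrixRel q θ (freeV n)) (freeV n i j)

/-- The free generators `V_{i,j}` in the presence of the further generator `D⁻¹`. -/
noncomputable def freeV' (n : ℕ) (i j : Fin n) : FreeAlgebra ℂ (Option (Fin n × Fin n)) :=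
  FreeAlgebra.ι ℂ (some (i, j))

/-- The further free generator `D⁻¹`. -/
noncomputable def freeDinv (n : ℕ) : FreeAlgebra ℂ (Option (Fin n × Fin n)) :=
  FreeAlgebra.ι ℂ none

/-- The defining relations of `ℂ[U_{q,Θ}(n)]`: those of `𝒜_{q,Θ}(n)`, the commutation of the
`V_{i,k}` with `D⁻¹` up to scalars, and `Det_q D⁻¹ = 1 = D⁻¹ Det_q`. -/
inductive UnitaryRel {n : ℕ} (q : ℝ) (θ : Matrix (Fin n) (Fin n) ℂ) :
    FreeAlgebra ℂ (Option (Fin n × Fin n)) → FreeAlgebra ℂ (Option (Fin n × Fin n)) → Prop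
  | mat {a b : FreeAlgebra ℂ (Option (Fin n × Fin n))}
      (h : MatrixRel q θ (freeV' n) a b) : UnitaryRel q θ a b
  | comm (i k : Fin n) :
      UnitaryRel q θ (freeV' n i k * freeDinv n)
        (((∏ a : Fin n with a ≠ k, θ k a) / (∏ a : Fin n with a ≠ i, θ i a)) •
          (freeDinv n * freeV' n i k))
  | det_mul_inv : UnitaryRel q θ (qDet q θ (freeV' n) * freeDinv n) 1
  | inv_mul_det : UnitaryRel q θ (freeDinv n * qDet q θ (freeV' n)) 1

/-- The algebra `ℂ[U_{q,Θ}(n)]`. -/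
abbrev QUnitary (n : ℕ) (q : ℝ) (θ : Matrix (Fin n) (Fin n) ℂ) : Type :=
  RingQuot (UnitaryRel q θ)

/-- The generator `V_{i,j}` of `ℂ[U_{q,Θ}(n)]`. -/
noncomputable def QUnitary.V {n : ℕ} (q : ℝ) (θ : Matrix (Fin n) (Fin n) ℂ) (i j : Fin n) :
    QUnitary n q θ :=
  RingQuot.mkAlgHom ℂ (UnitaryRel q θ) (freeV' n i j)

/-- The generator `D⁻¹` of `ℂ[U_{q,Θ}(n)]`. -/
noncomputable def QUnitary.Dinv {n : ℕ} (q : ℝ) (θ : Matrix (Fin n) (Fin n) ℂ) :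
    QUnitary n q θ :=
  RingQuot.mkAlgHom ℂ (UnitaryRel q θ) (freeDinv n)

theorem map_qDet {n : ℕ} (q : ℝ) (θ : Matrix (Fin n) (Fin n) ℂ)
    {A B : Type*} [Ring A] [Algebra ℂ A] [Ring B] [Algebra ℂ B] (f : A →ₐ[ℂ] B)
    (V : Fin n → Fin n → A) :
    f (qDet q θ V) = qDet q θ (fun i j => f (V i j)) := by
  simp only [qDet, map_sum, map_smul, map_list_prod, List.map_ofFn]
  rfl

/-- `Det_q` as an invertible element of `ℂ[U_{q,Θ}(n)]`, with inverse `D⁻¹`. -/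
noncomputable def QUnitary.detUnit {n : ℕ} (q : ℝ) (θ : Matrix (Fin n) (Fin n) ℂ) :
    (QUnitary n q θ)ˣ where
  val := qDet q θ (QUnitary.V q θ)
  inv := QUnitary.Dinv q θ
  val_inv := by
    have h := RingQuot.mkAlgHom_rel ℂ (UnitaryRel.det_mul_inv (q := q) (θ := θ))
    rw [map_mul, map_one, map_qDet] at h
    exact h
  inv_val := by
    have h := RingQuot.mkAlgHom_rel ℂ (UnitaryRel.inv_mul_det (q := q) (θ := θ))
    rw [map_mul, map_one, map_qDet] at h
    exact h

/-- The order `≤₀` on the positions of the generators: `V_{i,j} ≤₀ V_{k,l}` iff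
`i + j < k + l`, or `i + j = k + l` and `i ≤ k`. -/
def le0 {n : ℕ} (a b : Fin n × Fin n) : Prop :=
  a.1.val + a.2.val < b.1.val + b.2.val ∨
    (a.1.val + a.2.val = b.1.val + b.2.val ∧ a.1.val ≤ b.1.val)

instance le0_decidable {n : ℕ} : DecidableRel (le0 (n := n)) :=
  fun a b => by unfold le0; infer_instance

instance le0_isTrans {n : ℕ} : IsTrans (Fin n × Fin n) le0 :=
  ⟨fun a b c h₁ h₂ => by unfold le0 at *; omega⟩

instance le0_antisymm {n : ℕ} : Std.Antisymm (le0 (n := n)) :=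
  ⟨fun a b h₁ h₂ => by
    unfold le0 at *
    exact Prod.ext (Fin.ext (by omega)) (Fin.ext (by omega))⟩

instance le0_total {n : ℕ} : Std.Total (le0 (n := n)) :=
  ⟨fun a b => by unfold le0; omega⟩

/-- The ordered monomial with exponents `m`: the product of the powers `V_{i,j} ^ m_{i,j}`
of all `n²` generators, in increasing order for `≤₀`. -/
def orderedMonomial {n : ℕ} {A : Type*} [Monoid A] (V : Fin n → Fin n → A)
    (m : Fin n × Fin n → ℕ) : A :=
  (((Finset.univ : Finset (Fin n × Fin n)).sort le0).map fun p => V p.1 p.2 ^ m p).prod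

/-- The monomial block of the `s`-th anti-diagonal, `1 ≤ s ≤ 2n - 1`: the product of the powers
`V_{i,j} ^ m_{i,j}` with `i + j = s + 1` (one-based indices), by increasing row `i`.
In zero-based indices the condition reads `i + j + 1 = s`. -/
def block {n : ℕ} {A : Type*} [Monoid A] (V : Fin n → Fin n → A)
    (m : Fin n × Fin n → ℕ) (s : ℕ) : A :=
  ((((List.finRange n).product (List.finRange n)).filter
    fun p => p.1.val + p.2.val + 1 = s).map fun p => V p.1 p.2 ^ m p).prod

/-- The product `b₁ b₂ ⋯ b_{2n-1}` of the monomial blocks with exponents `m`. -/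
def blockProduct {n : ℕ} {A : Type*} [Monoid A] (V : Fin n → Fin n → A)
    (m : Fin n × Fin n → ℕ) : A :=
  ((List.range' 1 (2 * n - 1)).map (block V m)).prod

/-- Exponents such that the block of the main (`n`-th) anti-diagonal
`V_{1,n}, V_{2,n-1}, …, V_{n,1}` has at least one exponent zero. -/
abbrev ReducedExponents (n : ℕ) : Type :=
  {m : Fin n × Fin n → ℕ // ∃ i : Fin n, m (i, i.rev) = 0}

/-- The family `B̂` in `𝒜_{q,Θ}(n)`: reduced block products times `Det_q ^ k`, `k ≥ 0`. -/
noncomputable def Bhat {n : ℕ} (q : ℝ) (θ : Matrix (Fin n) (Fin n) ℂ)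
    (x : ReducedExponents n × ℕ) : QMat n q θ :=
  blockProduct (QMat.V q θ) x.1.1 * qDet q θ (QMat.V q θ) ^ x.2

/-- The family `B̃` in `ℂ[U_{q,Θ}(n)]`: reduced block products times `Det_q ^ k`, `k ∈ ℤ`. -/
noncomputable def Btilde {n : ℕ} (q : ℝ) (θ : Matrix (Fin n) (Fin n) ℂ)
    (x : ReducedExponents n × ℤ) : QUnitary n q θ :=
  blockProduct (QUnitary.V q θ) x.1.1 * ((QUnitary.detUnit q θ ^ x.2 : (QUnitary n q θ)ˣ) :
    QUnitary n q θ)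

end QuantumUnitary

/-!
The relations of `𝒜_{q,Θ}(n)` say that the matrix `V` of generators satisfies
`R̂ (V ⊗ V) = (V ⊗ V) R̂` for the Hecke R-matrix twisted by `Θ` (`IsQuantum`). This uniform form makes
products of commuting quantum matrices, homomorphisms and representations easy to handle.

*Ordered monomials.* They span for every order of the generators, because exchanging two neighbours
in a word produces a scalar multiple of the exchanged word and a word in which the weight `∑ i * j`
is smaller (`IsQuantum.word_mem_span`). For one lexicographic order they are independent, because
they act independently on a vector of a module that is built row by row: a new row is obtained from
`diag(X, 1)` by multiplication with a triangular quantum matrix made of `q`-oscillators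
(`exists_model`), and the twist by `Θ` is introduced afterwards by a cocycle
(`exists_twisted_model`). The relations are homogeneous and each degree has finitely many exponent
matrices, so spanning implies independence for every other order
(`linearIndependent_of_graded_span`).

*The determinant.* Crossing the volume element of the quantum exterior algebra shows that `Det_q`
commutes with each generator up to an explicit scalar (`IsQuantum.mul_qDet`). Call the total
distance from the main anti-diagonal of the positions above it the depth of a monomial. Straightening
within the positions on or above the anti-diagonal, or within those below it, preserves the depth, and
each term of `Det_q` is, up to a scalar, a product of a word of the first kind and one of the second
kind. Its depth is positive except for the anti-diagonal term. Hence `b_1(m) ⋯ b_{2n-1}(m) Det_q ^ k`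
is a nonzero multiple of the ordered monomial with exponents `m` plus `k` times the anti-diagonal,
modulo greater depth (`IsQuantum.monomial_mul_qDet_pow`). Every exponent matrix is uniquely of this
form with `m` reduced, and the depth is bounded in each degree, so `B̂` spans, and it is independent
by the graded count again (`span_Bhat`, `linearIndependent_Bhat`).

*Inverting the determinant.* Multiplication by `Det_q` on either side maps the basis `B̂` to a family
of multiples of distinct elements of `B̂`, so `Det_q` is regular; as it is also normal, `𝒜_{q,Θ}(n)`
embeds into its Ore localization and therefore into `ℂ[U_{q,Θ}(n)]` (`QMat.toQUnitary_injective`).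
A relation between elements of `B̃` multiplied by a high power of `Det_q` is one between elements of
`B̂`.
-/

namespace QuantumUnitary

open Finset

/-! ### Quantum matrices in a uniform notation -/

/-- The diagonal coefficients of the Hecke R-matrix: `q - 1` on equal indices, `q - q⁻¹` on
increasing pairs and `0` on decreasing ones. -/
noncomputable def hecke {ι : Type*} [LinearOrder ι] (q : ℂ) (a b : ι) : ℂ :=
  if a = b then q - 1 else if a < b then q - q⁻¹ else 0

@[simp] theorem hecke_self {ι : Type*} [LinearOrder ι] (q : ℂ) (a : ι) :
    hecke q a a = q - 1 := by
  simp [hecke]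

theorem hecke_of_lt {ι : Type*} [LinearOrder ι] (q : ℂ) {a b : ι} (h : a < b) :
    hecke q a b = q - q⁻¹ := by
  simp [hecke, h, h.ne]

theorem hecke_of_gt {ι : Type*} [LinearOrder ι] (q : ℂ) {a b : ι} (h : b < a) :
    hecke q a b = 0 := by
  simp [hecke, h.not_gt, h.ne']

/-- A (possibly rectangular) matrix `X` over a complex algebra is a quantum matrix if
`R̂ (X ⊗ X) = (X ⊗ X) R̂`, where `R̂` is the Hecke R-matrix whose flip coefficients are twisted by
`θr` on the row indices and by `θc` on the column indices.  The relation below is the component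
of this identity at the rows `i, k` and the columns `j, l`. -/
def IsQuantum {ι κ : Type*} [LinearOrder ι] [LinearOrder κ] (q : ℂ) (θr : ι → ι → ℂ)
    (θc : κ → κ → ℂ) {A : Type*} [Ring A] [Algebra ℂ A] (X : ι → κ → A) : Prop :=
  ∀ i k j l, hecke q i k • (X i j * X k l) + θr i k • (X k j * X i l) =
    hecke q j l • (X i j * X k l) + θc l j • (X i l * X k j)

/-- The componentwise form of the relations of a quantum matrix. -/
theorem IsQuantum.of_rel {ι κ : Type*} [LinearOrder ι] [LinearOrder κ] {q : ℂ} (hq' : q ≠ 0)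
    {θr : ι → ι → ℂ} {θc : κ → κ → ℂ} (hdr : ∀ i, θr i i = 1) (hdc : ∀ i, θc i i = 1)
    (hθr : ∀ i j, θr i j * θr j i = 1) (hθc : ∀ i j, θc i j * θc j i = 1)
    {A : Type*} [Ring A] [Algebra ℂ A] {V : ι → κ → A}
    (hrow : ∀ i j l, j < l → V i j * V i l = (q * θc l j) • (V i l * V i j))
    (hcol : ∀ i k j, i < k → V i j * V k j = (q * θr i k) • (V k j * V i j))
    (hanti : ∀ i k j l, i < k → j < l → θc l j • (V i l * V k j) = θr i k • (V k j * V i l))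
    (hdiag : ∀ i k j l, i < k → j < l → θc j l • (V i j * V k l) =
      θr i k • (V k l * V i j) + (q - q⁻¹) • (V i l * V k j)) :
    IsQuantum q θr θc V := by
  intro i k j l
  rcases lt_trichotomy i k with hik | rfl | hik <;>
    rcases lt_trichotomy j l with hjl | rfl | hjl
  · rw [hecke_of_lt _ hik, hecke_of_lt _ hjl, ← hanti i k j l hik hjl]
  · rw [hecke_of_lt _ hik, hecke_self, hcol i k j hik, hdc]
    match_scalars
    field_simp
    ring
  · rw [hecke_of_lt _ hik, hecke_of_gt _ hjl, hdiag i k l j hik hjl]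
    module
  · rw [hecke_of_lt _ hjl, hecke_self, hrow i j l hjl, hdr]
    match_scalars
    field_simp
    ring
  · simp [hdr, hdc]
  · rw [hecke_of_gt _ hjl, hecke_self, hrow i l j hjl, hdr]
    match_scalars
    linear_combination (-q) * hθc j l
  · rw [hecke_of_gt _ hik, hecke_of_lt _ hjl]
    have e := hdiag k i j l hik hjl
    have e' := congrArg (fun z => (θr i k * θc l j) • z) e
    simp only [smul_add, smul_smul] at e'
    have h1 := hθr i k
    have h2 := hθc l j
    rw [show θr i k * θc l j * θc j l = θr i k by linear_combination θr i k * h2,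
      show θr i k * θc l j * θr k i = θc l j by linear_combination θc l j * h1] at e'
    rw [e', zero_smul, zero_add]
    have e2 := congrArg (fun z => ((q - q⁻¹) * θr i k) • z) (hanti k i j l hik hjl)
    simp only [smul_smul] at e2
    rw [show θr i k * θc l j * (q - q⁻¹) = (q - q⁻¹) * θr i k * θc l j by ring, e2,
      show (q - q⁻¹) * θr i k * θr k i = q - q⁻¹ by
        linear_combination (q - q⁻¹) * h1]
    abel
  · rw [hecke_of_gt _ hik, hecke_self, hcol k i j hik, hdc]
    match_scalars
    linear_combination (q) * hθr i k
  · rw [hecke_of_gt _ hik, hecke_of_gt _ hjl]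
    have e := hanti k i l j hik hjl
    have e' := congrArg (fun z => (θr i k * θc l j) • z) e
    simp only [smul_smul] at e'
    have h1 := hθr i k
    have h2 := hθc l j
    rw [show θr i k * θc l j * θc j l = θr i k by linear_combination θr i k * h2,
      show θr i k * θc l j * θr k i = θc l j by linear_combination θc l j * h1] at e'
    rw [e']

section Relations

variable {n : ℕ} {q : ℝ} {θ : Matrix (Fin n) (Fin n) ℂ}
  {A : Type*} [Ring A] [Algebra ℂ A] {V : Fin n → Fin n → A}

theorem IsQuantum.of_matrixRel (hq : q ≠ 0) (hd : ∀ i, θ i i = 1)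
    (hθ : ∀ i j, θ i j * θ j i = 1) (h : ∀ a b, MatrixRel q θ V a b → a = b) :
    IsQuantum (q : ℂ) θ θ V :=
  .of_rel (by exact_mod_cast hq) hd hd hθ hθ (fun i j l hjl => h _ _ (.row i j l hjl))
    (fun i k j hik => h _ _ (.col i k j hik))
    (fun i k j l hik hjl => h _ _ (.antidiag i k j l hik hjl))
    fun i k j l hik hjl => by rw [← one_div, ← h _ _ (.diag i k j l hik hjl)]; abel

theorem IsQuantum.matrixRel (hq : q ≠ 0) (hd : ∀ i, θ i i = 1)
    (hV : IsQuantum (q : ℂ) θ θ V) {a b : A}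
    (h : MatrixRel q θ V a b) : a = b := by
  have hq' : (q : ℂ) ≠ 0 := by exact_mod_cast hq
  cases h with
  | row i j l hjl =>
    have e := hV i i j l
    rw [hecke_self, hecke_of_lt _ hjl, hd] at e
    have e' := congrArg (fun z => (q : ℂ) • (z - ((q : ℂ) - (q : ℂ)⁻¹) • (V i j * V i l))) e
    have h1 : (q : ℂ) • (((q : ℂ) - 1) • (V i j * V i l) + (1 : ℂ) • (V i j * V i l) -
        ((q : ℂ) - (q : ℂ)⁻¹) • (V i j * V i l)) = V i j * V i l := by
      match_scalars
      field_simp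
      ring
    rw [← h1, e']
    module
  | col i k j hik =>
    have e := hV i k j j
    rw [hecke_self, hecke_of_lt _ hik, hd] at e
    have e' := congrArg (fun z => (q : ℂ) • (z - ((q : ℂ) - (q : ℂ)⁻¹) • (V i j * V k j))) e
    have h1 : (q : ℂ) • (((q : ℂ) - 1) • (V i j * V k j) + (1 : ℂ) • (V i j * V k j) -
        ((q : ℂ) - (q : ℂ)⁻¹) • (V i j * V k j)) = V i j * V k j := by
      match_scalars
      field_simp
      ring
    rw [← h1, ← e']
    module
  | antidiag i k j l hik hjl =>
    have e := hV i k j l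
    rw [hecke_of_lt _ hjl, hecke_of_lt _ hik] at e
    exact (add_left_cancel e).symm
  | diag i k j l hik hjl =>
    have e := hV i k l j
    rw [hecke_of_gt _ hjl, hecke_of_lt _ hik, zero_smul, zero_add] at e
    rw [← e, one_div]
    abel

end Relations

/-- The relation `r = p R̂` between two families of "row vectors" in `V ⊗ V` is preserved when the
vectors are multiplied by a quantum matrix from the right. -/
theorem IsQuantum.transport {κ μ : Type*} [LinearOrder κ] [LinearOrder μ] [Fintype κ]
    {q : ℂ} {θr : κ → κ → ℂ} {θc : μ → μ → ℂ} {A : Type*} [Ring A] [Algebra ℂ A]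
    {X : κ → μ → A} (hX : IsQuantum q θr θc X) {p r : κ → κ → A}
    (h : ∀ a b, r a b = hecke q a b • p a b + θr b a • p b a) (j l : μ) :
    ∑ a, ∑ b, r a b * (X a j * X b l) =
      hecke q j l • ∑ a, ∑ b, p a b * (X a j * X b l) +
        θc l j • ∑ a, ∑ b, p a b * (X a l * X b j) := by
  have h1 : ∑ a, ∑ b, r a b * (X a j * X b l) =
      ∑ a, ∑ b, p a b * (hecke q a b • (X a j * X b l) + θr a b • (X b j * X a l)) := by
    simp only [h, add_mul, mul_add, sum_add_distrib, smul_mul_assoc, mul_smul_comm]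
    congr 1
    exact sum_comm
  rw [h1, smul_sum, smul_sum, ← sum_add_distrib]
  refine sum_congr rfl fun a _ => ?_
  rw [smul_sum, smul_sum, ← sum_add_distrib]
  refine sum_congr rfl fun b _ => ?_
  rw [hX a b j l, mul_add, mul_smul_comm, mul_smul_comm]

theorem sum_mul_sum_of_commute {κ A : Type*} [Fintype κ] [Ring A] {u x v y : κ → A}
    (hc : ∀ a b, Commute (x a) (v b)) :
    (∑ a, u a * x a) * (∑ b, v b * y b) = ∑ a, ∑ b, (u a * v b) * (x a * y b) := by
  rw [sum_mul_sum]
  refine sum_congr rfl fun a _ => sum_congr rfl fun b _ => ?_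
  rw [mul_assoc, ← mul_assoc (x a), (hc a b).eq]
  simp only [mul_assoc]

/-- The product of two quantum matrices with mutually commuting entries is a quantum matrix. -/
theorem IsQuantum.mul {ι κ μ : Type*} [LinearOrder ι] [LinearOrder κ] [LinearOrder μ] [Fintype κ]
    {q : ℂ} {θ₁ : ι → ι → ℂ} {θ₂ : κ → κ → ℂ} {θ₃ : μ → μ → ℂ} {A : Type*} [Ring A]
    [Algebra ℂ A] {X : ι → κ → A} {T : κ → μ → A} (hX : IsQuantum q θ₁ θ₂ X)
    (hT : IsQuantum q θ₂ θ₃ T) (hc : ∀ i a b j, Commute (X i a) (T b j)) :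
    IsQuantum q θ₁ θ₃ fun i j => ∑ a, X i a * T a j := by
  intro i k j l
  have := hT.transport (p := fun a b => X i a * X k b)
    (r := fun a b => hecke q i k • (X i a * X k b) + θ₁ i k • (X k a * X i b))
    (fun a b => hX i k a b) j l
  simp only [add_mul, sum_add_distrib, smul_mul_assoc, ← smul_sum] at this
  simpa only [sum_mul_sum_of_commute fun a b => (hc _ b a _).symm] using this

theorem IsQuantum.map {ι κ : Type*} [LinearOrder ι] [LinearOrder κ] {q : ℂ} {θr : ι → ι → ℂ}
    {θc : κ → κ → ℂ} {A B : Type*} [Ring A] [Algebra ℂ A] [Ring B] [Algebra ℂ B]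
    {X : ι → κ → A} (hX : IsQuantum q θr θc X) (f : A →ₐ[ℂ] B) :
    IsQuantum q θr θc fun i j => f (X i j) := fun i k j l => by
  simpa using congrArg f (hX i k j l)

/-! ### The quantum exterior algebra and its crossing with the vector representation -/

section Fermions

variable {ι : Type*} [LinearOrder ι] (q : ℂ) (θ : ι → ι → ℂ) (A : Type*) [Ring A] [Algebra ℂ A]

/-- The factor for moving `ξ_a` past `ξ_s` into increasing position. -/
noncomputable def extCoeff (s a : ι) : ℂ := if s < a then -q * θ s a else 1

/-- Left multiplication by the generator `ξ_a` of the quantum exterior algebra; the function `w`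
stands for `∑ S, w S ξ^S`. -/
noncomputable def extMul (a : ι) : Module.End ℂ (Finset ι → A) where
  toFun w S := if a ∈ S then (∏ s ∈ S, extCoeff q θ s a) • w (S.erase a) else 0
  map_add' v w := by ext S; by_cases h : a ∈ S <;> simp [h]
  map_smul' c w := by ext S; by_cases h : a ∈ S <;> simp [h, smul_comm c]

/-- The factor with which `ξ_s` enters the annihilation operator of `ξ_k`. -/
noncomputable def annCoeff (s k : ι) : ℂ := if s < k then (-q)⁻¹ else if k < s then θ s k else 1

/-- The operator removing `ξ_k`, normalised such that `extMul b * extAnn k` is the off-diagonal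
entry `(k, b)`, `k < b`, of the crossing of the vector representation with the quantum exterior
algebra. -/
noncomputable def extAnn (k : ι) : Module.End ℂ (Finset ι → A) where
  toFun w S := if k ∈ S then 0 else
    (-(q - q⁻¹) * ∏ s ∈ S, annCoeff q θ s k) • w (insert k S)
  map_add' v w := by ext S; by_cases h : k ∈ S <;> simp [h]
  map_smul' c w := by ext S; by_cases h : k ∈ S <;> simp [h, smul_comm c]

/-- The diagonal entries of the crossing. -/
noncomputable def extDiag (k : ι) : Module.End ℂ (Finset ι → A) where
  toFun w S := ((if k ∈ S then q⁻¹ else 1) * ∏ s ∈ S, θ s k) • w S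
  map_add' v w := by ext S; simp
  map_smul' c w := by ext S; simp only [Pi.smul_apply, RingHom.id_apply, smul_comm c]

variable {A}

theorem extMul_apply (a : ι) (w : Finset ι → A) (S : Finset ι) : extMul q θ A a w S =
    if a ∈ S then (∏ s ∈ S, extCoeff q θ s a) • w (S.erase a) else 0 := rfl

theorem extAnn_apply (k : ι) (w : Finset ι → A) (S : Finset ι) : extAnn q θ A k w S =
    if k ∈ S then 0 else (-(q - q⁻¹) * ∏ s ∈ S, annCoeff q θ s k) • w (insert k S) := rfl

theorem extDiag_apply (k : ι) (w : Finset ι → A) (S : Finset ι) : extDiag q θ A k w S =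
    ((if k ∈ S then q⁻¹ else 1) * ∏ s ∈ S, θ s k) • w S := rfl

variable (A)

theorem extMul_mul_self (a : ι) : extMul q θ A a * extMul q θ A a = 0 := by
  ext w S
  simp [extMul_apply]

theorem extMul_mul_of_lt {a b : ι} (h : a < b) :
    extMul q θ A b * extMul q θ A a = (-q * θ a b) • (extMul q θ A a * extMul q θ A b) := by
  ext w S
  simp only [Module.End.mul_apply, LinearMap.smul_apply, Pi.smul_apply, extMul_apply, mem_erase]
  by_cases ha : a ∈ S <;> by_cases hb : b ∈ S <;> simp only [ha, hb, h.ne, h.ne', ne_eq,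
    not_false_eq_true, and_self, and_false, if_true, if_false, smul_zero]
  rw [prod_erase S (a := b) (by simp [extCoeff, h.not_gt]),
    ← mul_prod_erase S (fun s => extCoeff q θ s b) ha,
    erase_right_comm, smul_smul, smul_smul, smul_smul]
  congr 1
  simp only [extCoeff, h, if_true]
  ring

theorem extAnn_mul_extMul {a k : ι} (h : a ≠ k) : extAnn q θ A k * extMul q θ A a =
    (extCoeff q θ k a * annCoeff q θ a k) • (extMul q θ A a * extAnn q θ A k) := by
  ext w S
  simp only [Module.End.mul_apply, LinearMap.smul_apply, Pi.smul_apply, extMul_apply, extAnn_apply,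
    mem_erase, mem_insert]
  by_cases hk : k ∈ S <;> by_cases ha : a ∈ S <;> simp only [hk, ha, h, h.symm, ne_eq,
    not_false_eq_true, or_true, or_self, and_self, and_false, if_true, if_false,
    smul_zero]
  rw [prod_insert hk, ← mul_prod_erase S (fun s => annCoeff q θ s k) ha,
    erase_insert_of_ne h.symm, smul_smul, smul_smul, smul_smul]
  congr 1
  ring

theorem extAnn_mul_extMul_self (hq : q ≠ 0) {k : ι} (hd : ∀ i, θ i i = 1) :
    extAnn q θ A k * extMul q θ A k =
    (-q⁻¹) • (extMul q θ A k * extAnn q θ A k) - (q - q⁻¹) • extDiag q θ A k := by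
  have key : ∀ S : Finset ι, (∏ s ∈ S, extCoeff q θ s k) * ∏ s ∈ S, annCoeff q θ s k =
      ∏ s ∈ S, θ s k := fun S => by
    rw [← prod_mul_distrib]
    refine prod_congr rfl fun s _ => ?_
    rcases lt_trichotomy s k with h | rfl | h
    · simp only [extCoeff, annCoeff, h, if_true]
      field_simp
    · simp [extCoeff, annCoeff, hd]
    · simp [extCoeff, annCoeff, h, h.not_gt]
  ext w S
  simp only [Module.End.mul_apply, LinearMap.smul_apply, Pi.smul_apply, extMul_apply, extAnn_apply,
    extDiag_apply, mem_insert_self, if_true, mem_erase, LinearMap.sub_apply, Pi.sub_apply]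
  by_cases hk : k ∈ S <;> simp only [hk, ne_eq, not_true_eq_false, false_and, if_true, if_false]
  · rw [insert_erase hk, prod_erase S (a := k) (by simp [annCoeff]), ← key, smul_smul, smul_smul,
      smul_smul, ← sub_smul]
    symm
    convert zero_smul ℂ (w S)
    ring
  · rw [erase_insert hk, prod_insert hk, smul_zero, ← key, smul_smul, smul_smul, zero_sub,
      ← neg_smul]
    congr 1
    simp only [extCoeff, lt_self_iff_false, if_false]
    ring

theorem extDiag_mul_extMul {a k : ι} (h : a ≠ k) : extDiag q θ A k * extMul q θ A a =
    θ a k • (extMul q θ A a * extDiag q θ A k) := by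
  ext w S
  simp only [Module.End.mul_apply, LinearMap.smul_apply, Pi.smul_apply, extMul_apply,
    extDiag_apply, mem_erase, h.symm, ne_eq, not_false_eq_true, true_and]
  by_cases ha : a ∈ S <;> simp only [ha, if_true, if_false, smul_zero]
  rw [← mul_prod_erase S (fun s => θ s k) ha, smul_smul, smul_smul, smul_smul]
  congr 1
  ring

theorem extDiag_mul_extMul_self {k : ι} (hd : ∀ i, θ i i = 1) :
    extDiag q θ A k * extMul q θ A k = q⁻¹ • (extMul q θ A k * extDiag q θ A k) := by
  ext w S
  simp only [Module.End.mul_apply, LinearMap.smul_apply, Pi.smul_apply, extMul_apply,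
    extDiag_apply, mem_erase, ne_eq, not_true_eq_false, false_and, if_false]
  by_cases hk : k ∈ S <;> simp only [hk, if_true, if_false, smul_zero]
  rw [← mul_prod_erase S (fun s => θ s k) hk, smul_smul, smul_smul, smul_smul, hd]
  congr 1
  ring

/-- The matrix of operators by which the `b`-th basis vector of the vector representation passes
the quantum exterior algebra and leaves it as the `k`-th basis vector. -/
noncomputable def extCross (k b : ι) : Module.End ℂ (Finset ι → A) :=
  if k = b then extDiag q θ A k else if k < b then extMul q θ A b * extAnn q θ A k else 0

/-- The relations of the quantum exterior algebra: `ξ ⊗ ξ` is an eigenvector of the Hecke R-matrix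
for the eigenvalue `-q⁻¹`. -/
theorem extMul_rel (hq : q ≠ 0) (hθ : ∀ i j, θ i j * θ j i = 1) (a b : ι) :
    (-q⁻¹) • (extMul q θ A a * extMul q θ A b) =
      hecke q a b • (extMul q θ A a * extMul q θ A b) +
        θ b a • (extMul q θ A b * extMul q θ A a) := by
  rcases lt_trichotomy a b with h | rfl | h
  · rw [hecke_of_lt _ h, extMul_mul_of_lt q θ A h]
    match_scalars
    linear_combination q * hθ b a
  · simp [extMul_mul_self]
  · rw [hecke_of_gt _ h, extMul_mul_of_lt q θ A h, smul_smul, zero_smul, zero_add]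
    congr 1
    field_simp

theorem extAnn_mul_extMul_of_gt (hθ : ∀ i j, θ i j * θ j i = 1) {a k : ι} (h : k < a) :
    extAnn q θ A k * extMul q θ A a = (-q) • (extMul q θ A a * extAnn q θ A k) := by
  rw [extAnn_mul_extMul q θ A h.ne']
  congr 1
  simp only [extCoeff, annCoeff, h, h.not_gt, if_true, if_false]
  linear_combination (-q) * hθ k a

theorem extAnn_mul_extMul_of_lt {a k : ι} (h : a < k) :
    extAnn q θ A k * extMul q θ A a = (-q⁻¹) • (extMul q θ A a * extAnn q θ A k) := by
  rw [extAnn_mul_extMul q θ A h.ne]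
  congr 1
  simp only [extCoeff, annCoeff, h, h.not_gt, if_true, if_false, one_mul, inv_neg]

/-- The crossing is compatible with multiplication in the exterior algebra: as a family of vectors
indexed by pairs, `ξ_a * extCross k b` is the image of `extCross k a * ξ_b` under the Hecke R-matrix. -/
theorem extMul_mul_extCross (hq : q ≠ 0) (hd : ∀ i, θ i i = 1) (hθ : ∀ i j, θ i j * θ j i = 1)
    (k a b : ι) :
    extMul q θ A a * extCross q θ A k b =
      hecke q a b • (extCross q θ A k a * extMul q θ A b) +
        θ b a • (extCross q θ A k b * extMul q θ A a) := by
  rcases lt_trichotomy k b with hb | rfl | hb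
  · have e1 : extCross q θ A k b = extMul q θ A b * extAnn q θ A k := by
      simp [extCross, hb, hb.ne]
    rw [e1, mul_assoc (extMul q θ A b)]
    rcases lt_trichotomy a b with hab | rfl | hab
    · rw [hecke_of_lt _ hab]
      rcases lt_trichotomy a k with hak | rfl | hak
      · rw [extAnn_mul_extMul_of_lt q θ A hak, mul_smul_comm, ← mul_assoc,
          ← mul_assoc (extMul q θ A b), extMul_mul_of_lt q θ A hab]
        simp only [extCross, hak.ne', hak.not_gt, if_false, zero_mul, smul_zero, zero_add,
          smul_mul_assoc, smul_smul]
        symm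
        convert one_smul ℂ _
        field_simp
        linear_combination hθ b a
      · rw [extAnn_mul_extMul_self q θ A hq hd, mul_sub, mul_smul_comm, mul_smul_comm, ← mul_assoc,
          ← mul_assoc (extMul q θ A b), extMul_mul_of_lt q θ A hab]
        have e2 := extDiag_mul_extMul q θ A hab.ne'
        simp only [extCross, if_true]
        rw [e2, smul_mul_assoc]
        match_scalars
        · field_simp
          linear_combination -hθ b a
        · ring
      · have e2 : extCross q θ A k a = extMul q θ A a * extAnn q θ A k := by
          simp [extCross, hak, hak.ne]
        rw [e2, mul_assoc (extMul q θ A a) _ (extMul q θ A b), extAnn_mul_extMul_of_gt q θ A hθ hak,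
          extAnn_mul_extMul_of_gt q θ A hθ hb, mul_smul_comm, mul_smul_comm, ← mul_assoc,
          ← mul_assoc (extMul q θ A b), extMul_mul_of_lt q θ A hab, smul_mul_assoc]
        match_scalars
        field_simp
        linear_combination -q ^ 2 * hθ b a
    · rw [e1, mul_assoc (extMul q θ A a), extAnn_mul_extMul_of_gt q θ A hθ hb, mul_smul_comm,
        ← mul_assoc, extMul_mul_self]
      simp
    · rw [hecke_of_gt _ hab, extAnn_mul_extMul_of_gt q θ A hθ (hb.trans hab), mul_smul_comm,
        ← mul_assoc, ← mul_assoc, extMul_mul_of_lt q θ A hab, smul_mul_assoc]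
      match_scalars <;> ring
  · have e1 : extCross q θ A k k = extDiag q θ A k := by simp [extCross]
    rw [e1]
    rcases lt_trichotomy a k with hak | rfl | hak
    · rw [extDiag_mul_extMul q θ A hak.ne, smul_smul, hθ]
      simp [extCross, hak.ne', hak.not_gt]
    · rw [e1, extDiag_mul_extMul_self q θ A hd, hecke_self, hd]
      match_scalars
      field_simp
      ring
    · rw [extDiag_mul_extMul q θ A hak.ne', smul_smul, hθ, hecke_of_gt _ hak]
      simp
  · have e1 : extCross q θ A k b = 0 := by simp [extCross, hb.ne', hb.not_gt]
    rw [e1]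
    rcases le_or_gt a b with hab | hab
    · have hak := hab.trans_lt hb
      simp [extCross, hak.ne', hak.not_gt]
    · simp [hecke_of_gt _ hab]

end Fermions

/-! ### The quantum determinant is normal -/

/-! In this section `η` satisfies the relations of the generators of the quantum exterior algebra and
`f` those of a row of its crossing; the volume element is the ordered product of all `η j`. -/

section Volume

variable {ι : Type*} [LinearOrder ι] {q : ℂ} {θ : ι → ι → ℂ} {B : Type*} [Ring B] [Algebra ℂ B]
  {η f : ι → B}

theorem ext_mul_self (hq : q ≠ 0) (hq2 : q ^ 2 + 1 ≠ 0) (hd : ∀ i, θ i i = 1)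
    (hη : ∀ j l, (-q⁻¹) • (η j * η l) = hecke q j l • (η j * η l) + θ l j • (η l * η j)) (j : ι) :
    η j * η j = 0 := by
  have h := hη j j
  rw [hecke_self, hd, ← add_smul, ← sub_eq_zero, ← sub_smul] at h
  refine (smul_eq_zero.mp h).resolve_left fun h0 => hq2 ?_
  field_simp at h0
  linear_combination -h0

theorem ext_mul_comm (hq : q ≠ 0)
    (hη : ∀ j l, (-q⁻¹) • (η j * η l) = hecke q j l • (η j * η l) + θ l j • (η l * η j))
    {j l : ι} (h : j ≠ l) : ∃ c : ℂ, η j * η l = c • (η l * η j) := by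
  rcases lt_or_gt_of_ne h with h | h
  · have e := hη j l
    rw [hecke_of_lt _ h] at e
    refine ⟨-q⁻¹ * θ l j, ?_⟩
    have : η j * η l = (-q⁻¹) • ((-q⁻¹) • (η j * η l) - (q - q⁻¹) • (η j * η l)) := by
      match_scalars
      field_simp
      ring
    rw [this, e]
    module
  · have e := hη j l
    rw [hecke_of_gt _ h, zero_smul, zero_add] at e
    refine ⟨-q * θ l j, ?_⟩
    have : η j * η l = (-q) • ((-q⁻¹) • (η j * η l)) := by
      match_scalars
      field_simp
    rw [this, e, smul_smul]

theorem ext_mul_prod_eq_zero (h0 : ∀ j, η j * η j = 0)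
    (hη : ∀ j l, j ≠ l → ∃ c : ℂ, η j * η l = c • (η l * η j)) (l : ι) :
    ∀ I : List ι, l ∈ I → η l * (I.map η).prod = 0 := by
  intro I
  induction I with
  | nil => simp
  | cons j I ih =>
    intro hl
    rw [List.map_cons, List.prod_cons, ← mul_assoc]
    by_cases hj : l = j
    · rw [hj, h0, zero_mul]
    · obtain ⟨c, hc⟩ := hη l j hj
      rw [hc, smul_mul_assoc, mul_assoc, ih ((List.mem_cons.mp hl).resolve_left hj), mul_zero,
        smul_zero]

theorem cross_mul_prod_of_lt (hθ : ∀ i j, θ i j * θ j i = 1)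
    (hf : ∀ j l, η j * f l = hecke q j l • (f j * η l) + θ l j • (f l * η j)) (l : ι) :
    ∀ I : List ι, (∀ j ∈ I, l < j) →
      f l * (I.map η).prod = (I.map fun j => θ j l).prod • ((I.map η).prod * f l) := by
  intro I
  induction I with
  | nil => simp
  | cons j I ih =>
    intro hI
    have h := hf j l
    rw [hecke_of_gt _ (hI j (by simp)), zero_smul, zero_add] at h
    have h' : f l * η j = θ j l • (η j * f l) := by rw [h, smul_smul, hθ, one_smul]
    simp only [List.map_cons, List.prod_cons]
    rw [← mul_assoc, h', smul_mul_assoc, mul_assoc, ih fun j' hj' => hI j' (by simp [hj']),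
      mul_smul_comm, smul_smul, mul_assoc]

/-- Passing the volume element multiplies the crossing vector by a scalar: the corrections
`η l * ⋯ * η l` arising on the way vanish. -/
theorem cross_mul_prod (hq : q ≠ 0) (hd : ∀ i, θ i i = 1) (hθ : ∀ i j, θ i j * θ j i = 1)
    (h0 : ∀ j, η j * η j = 0) (hη : ∀ j l, j ≠ l → ∃ c : ℂ, η j * η l = c • (η l * η j))
    (hf : ∀ j l, η j * f l = hecke q j l • (f j * η l) + θ l j • (f l * η j)) (l : ι) :
    ∀ I : List ι, I.Pairwise (· < ·) → l ∈ I →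
      f l * (I.map η).prod = (q⁻¹ * (I.map fun j => θ j l).prod) • ((I.map η).prod * f l) := by
  intro I
  induction I with
  | nil => simp
  | cons j I ih =>
    intro hI hl
    rw [List.pairwise_cons] at hI
    have h := hf j l
    simp only [List.map_cons, List.prod_cons]
    by_cases hj : j = l
    · subst hj
      rw [hecke_self, hd, ← add_smul, sub_add_cancel] at h
      have h' : f j * η j = q⁻¹ • (η j * f j) := by rw [h, smul_smul, inv_mul_cancel₀ hq, one_smul]
      rw [← mul_assoc, h', smul_mul_assoc, mul_assoc, cross_mul_prod_of_lt hθ hf j I hI.1,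
        mul_smul_comm, smul_smul, mul_assoc, hd, one_mul]
    · have hl' : l ∈ I := (List.mem_cons.mp hl).resolve_left (Ne.symm hj)
      rw [hecke_of_lt _ (hI.1 l hl')] at h
      have h' : f l * η j = θ j l • (η j * f l) - (θ j l * (q - q⁻¹)) • (f j * η l) := by
        rw [h, smul_add, smul_smul, smul_smul, hθ]
        module
      rw [← mul_assoc, h', sub_mul, smul_mul_assoc, smul_mul_assoc, mul_assoc, mul_assoc,
        ext_mul_prod_eq_zero h0 hη l I hl', ih hI.2 hl', mul_zero, smul_zero, sub_zero,
        mul_smul_comm, smul_smul, mul_assoc]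
      congr 1
      ring

end Volume

section Vacuum

variable {ι : Type*} [LinearOrder ι] (q : ℂ) (θ : ι → ι → ℂ) {A : Type*} [Ring A] [Algebra ℂ A]

theorem extCross_single_empty (k b : ι) (x : A) :
    extCross q θ A k b (Pi.single ∅ x) = if k = b then Pi.single ∅ x else 0 := by
  have h0 : extAnn q θ A k (Pi.single ∅ x) = 0 := by
    ext S
    simp [extAnn_apply, insert_ne_empty]
  by_cases h : k = b
  · rw [if_pos h, extCross, if_pos h]
    ext S
    by_cases hS : S = ∅
    · simp [extDiag_apply, hS]
    · simp [extDiag_apply, hS]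
  · rw [if_neg h, extCross, if_neg h]
    split_ifs
    · rw [Module.End.mul_apply, h0, map_zero]
    · rfl

theorem extCross_univ [Fintype ι] (k b : ι) (w : Finset ι → A) :
    extCross q θ A k b w univ = if k = b then (q⁻¹ * ∏ s, θ s k) • w univ else 0 := by
  by_cases h : k = b
  · rw [if_pos h, extCross, if_pos h]
    simp [extDiag_apply]
  · rw [if_neg h, extCross, if_neg h]
    split_ifs with h2
    · rw [Module.End.mul_apply, extMul_apply]
      simp [extAnn_apply, h]
    · rfl

/-- A product of generators of the exterior algebra applied to the vacuum is supported on the set of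
its factors, and vanishes if a factor is repeated. -/
theorem prod_extMul_single (I : List ι) (x : A) (S : Finset ι)
    (h : (I.map (extMul q θ A)).prod (Pi.single ∅ x) S ≠ 0) :
    I.toFinset = S ∧ I.length = S.card := by
  induction I generalizing S with
  | nil =>
    by_contra hS
    refine h ?_
    have : S ≠ ∅ := fun h' => hS (by simp [h'])
    simp [this]
  | cons a I ih =>
    rw [List.map_cons, List.prod_cons, Module.End.mul_apply, extMul_apply] at h
    by_cases ha : a ∈ S
    · rw [if_pos ha] at h
      obtain ⟨h1, h2⟩ := ih (S.erase a) fun h0 => h (by rw [h0, smul_zero])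
      rw [card_erase_of_mem ha] at h2
      have := card_pos.mpr ⟨a, ha⟩
      refine ⟨by rw [List.toFinset_cons, h1, insert_erase ha], ?_⟩
      rw [List.length_cons]
      omega
    · simp [ha] at h

/-- Reordering a product of distinct generators of the exterior algebra produces the inversion
factors that occur in the quantum determinant. -/
theorem prod_extMul_single_of_injective {m : ℕ} (g : Fin m → ι) (hg : Function.Injective g)
    (x : A) :
    (List.ofFn fun c => extMul q θ A (g c)).prod (Pi.single ∅ x) =
      Pi.single (univ.image g)
        ((∏ p : Fin m × Fin m with p.1 < p.2 ∧ g p.2 < g p.1, (-q * θ (g p.2) (g p.1))) • x) := by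
  induction m with
  | zero => simp
  | succ m ih =>
    have hg' : Function.Injective fun c : Fin m => g c.succ :=
      hg.comp (Fin.succ_injective m)
    rw [List.ofFn_succ, List.prod_cons, Module.End.mul_apply, ih _ hg']
    have hu : (univ.image g : Finset ι) = insert (g 0) (univ.image fun c : Fin m => g c.succ) := by
      ext a
      simp [Fin.exists_fin_succ, eq_comm]
    have h0 : g 0 ∉ univ.image fun c : Fin m => g c.succ := by
      simp only [mem_image, mem_univ, true_and, not_exists]
      exact fun c hc => Fin.succ_ne_zero c (hg hc)
    ext S
    rw [extMul_apply, hu, Pi.single_apply, Pi.single_apply]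
    by_cases hS : S = insert (g 0) (univ.image fun c : Fin m => g c.succ)
    · subst hS
      rw [if_pos (mem_insert_self _ _), if_pos rfl, erase_insert h0, if_pos rfl, smul_smul,
        prod_insert h0, prod_image fun a _ b _ h => hg' h]
      congr 1
      simp only [prod_filter, Fintype.prod_prod_type, Fin.prod_univ_succ, extCoeff]
      simp
    · rw [if_neg hS]
      split_ifs with h1 h2
      · exact absurd (by rw [← h2, insert_erase h1]) hS
      · simp
      · rfl

end Vacuum

theorem list_prod_ofFn_mul {B : Type*} [Monoid B] {m : ℕ} (u x : Fin m → B)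
    (hc : ∀ i j, Commute (x i) (u j)) :
    (List.ofFn fun c => u c * x c).prod = (List.ofFn u).prod * (List.ofFn x).prod := by
  induction m with
  | zero => simp
  | succ m ih =>
    simp only [List.ofFn_succ, List.prod_cons]
    rw [ih (fun c => u c.succ) (fun c => x c.succ) fun i j => hc _ _, mul_assoc, mul_assoc,
      ← mul_assoc (x 0), ← mul_assoc _ (x 0)]
    have : Commute (x 0) (List.ofFn fun c : Fin m => u c.succ).prod := by
      refine Commute.list_prod_right _ _ fun y hy => ?_
      obtain ⟨j, rfl⟩ := List.mem_ofFn.mp hy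
      exact hc _ _
    rw [this.eq]

theorem list_prod_ofFn_sum {B κ : Type*} [Ring B] [Algebra ℂ B] [Fintype κ] {m : ℕ}
    (u : Fin m → κ → B) :
    (List.ofFn fun c => ∑ a, u c a).prod = ∑ g : Fin m → κ, (List.ofFn fun c => u c (g c)).prod := by
  classical
  have := (MultilinearMap.mkPiAlgebraFin ℂ m B).map_sum u
  simpa using this

section Commute

variable {ι : Type*} [LinearOrder ι] (q : ℂ) (θ : ι → ι → ℂ) {A : Type*} [Ring A] [Algebra ℂ A]

theorem commute_lsmul_extMul (x : A) (a : ι) :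
    Commute (Algebra.lsmul ℂ ℂ (Finset ι → A) x) (extMul q θ A a) := by
  ext w S
  by_cases ha : a ∈ S <;> simp [extMul_apply, ha]

theorem commute_lsmul_extCross (x : A) (k a : ι) :
    Commute (Algebra.lsmul ℂ ℂ (Finset ι → A) x) (extCross q θ A k a) := by
  have h1 : Commute (Algebra.lsmul ℂ ℂ (Finset ι → A) x) (extDiag q θ A k) := by
    ext w S
    simp [extDiag_apply]
  have h2 : Commute (Algebra.lsmul ℂ ℂ (Finset ι → A) x) (extAnn q θ A k) := by
    ext w S
    by_cases hk : k ∈ S <;> simp [extAnn_apply, hk]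
  unfold extCross
  split_ifs
  · exact h1
  · exact (commute_lsmul_extMul q θ x a).mul_right h2
  · exact Commute.zero_right _

end Commute

section Normal

variable {n : ℕ} {q : ℝ} {θ : Fin n → Fin n → ℂ} {A : Type*} [Ring A] [Algebra ℂ A]
  {V : Fin n → Fin n → A}

theorem qDet_eq (q : ℝ) (θ : Fin n → Fin n → ℂ) (V : Fin n → Fin n → A) :
    qDet q θ V = ∑ σ : Equiv.Perm (Fin n),
      (∏ p : Fin n × Fin n with p.1 < p.2 ∧ σ p.2 < σ p.1,
        (-(q : ℂ) * θ (σ p.2) (σ p.1))) • (List.ofFn fun c : Fin n => V (σ c) c).prod := rfl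

/-- The top coefficient of `η_1 ⋯ η_n`, `η_j = ∑ a, ξ_a V_{a,j}`, is the quantum determinant. -/
theorem prod_ext_univ (x : A) :
    (List.ofFn fun j => ∑ a, extMul (q : ℂ) θ A a *
      Algebra.lsmul ℂ ℂ (Finset (Fin n) → A) (V a j)).prod (Pi.single ∅ x) univ =
      qDet q θ V * x := by
  rw [list_prod_ofFn_sum, LinearMap.sum_apply, Finset.sum_apply, qDet_eq, sum_mul]
  symm
  have key : ∀ g : Fin n → Fin n, (List.ofFn fun c => extMul (q : ℂ) θ A (g c) *
      Algebra.lsmul ℂ ℂ (Finset (Fin n) → A) (V (g c) c)).prod (Pi.single ∅ x) =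
      (List.ofFn fun c => extMul (q : ℂ) θ A (g c)).prod
        (Pi.single ∅ ((List.ofFn fun c => V (g c) c).prod * x)) := fun g => by
    rw [list_prod_ofFn_mul, Module.End.mul_apply]
    · congr 1
      have : (List.ofFn fun c => Algebra.lsmul ℂ ℂ (Finset (Fin n) → A) (V (g c) c)).prod =
          Algebra.lsmul ℂ ℂ (Finset (Fin n) → A) (List.ofFn fun c => V (g c) c).prod := by
        rw [map_list_prod, List.map_ofFn]
        rfl
      rw [this]
      ext S
      by_cases hS : S = ∅
      · subst hS
        simp
      · simp [hS]
    · exact fun i j => commute_lsmul_extMul _ _ _ _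
  refine sum_of_injOn (fun σ : Equiv.Perm (Fin n) => (σ : Fin n → Fin n))
    (fun _ _ _ _ h => DFunLike.coe_injective h) (fun _ _ => by simp) ?_ ?_
  · intro g _ hg
    rw [key]
    by_contra h0
    have h1 := (prod_extMul_single (q : ℂ) θ (List.ofFn g) _ univ
      (by rwa [List.map_ofFn])).1
    have hs : Function.Surjective g := fun a => by
      have : a ∈ (List.ofFn g).toFinset := by rw [h1]; exact mem_univ a
      simpa using this
    exact hg ⟨Equiv.ofBijective g ⟨Finite.injective_iff_surjective.mpr hs, hs⟩, by simp, rfl⟩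
  · intro σ _
    rw [key, prod_extMul_single_of_injective _ _ _ σ.injective]
    rw [image_univ_equiv, Pi.single_eq_same, smul_mul_assoc]

/-- The quantum determinant commutes with each generator up to an explicit scalar. -/
theorem IsQuantum.mul_qDet (hq : q ≠ 0) (hd : ∀ i, θ i i = 1) (hθ : ∀ i j, θ i j * θ j i = 1)
    (hV : IsQuantum (q : ℂ) θ θ V) (k l : Fin n) :
    (∏ s, θ s k) • (V k l * qDet q θ V) = (∏ s, θ s l) • (qDet q θ V * V k l) := by
  have hq' : (q : ℂ) ≠ 0 := by exact_mod_cast hq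
  have hq2 : (q : ℂ) ^ 2 + 1 ≠ 0 := by
    have : q ^ 2 + 1 ≠ 0 := by positivity
    exact_mod_cast this
  set X : Fin n → Fin n → Module.End ℂ (Finset (Fin n) → A) :=
    fun i j => Algebra.lsmul ℂ ℂ (Finset (Fin n) → A) (V i j) with hX
  have hXq : IsQuantum (q : ℂ) θ θ X := hV.map (Algebra.lsmul ℂ ℂ (Finset (Fin n) → A))
  set η := fun j => ∑ a, extMul (q : ℂ) θ A a * X a j with hηdef
  set f := fun j => ∑ a, extCross (q : ℂ) θ A k a * X a j with hfdef
  have cη : ∀ a i j, Commute (X i j) (extMul (q : ℂ) θ A a) :=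
    fun a i j => commute_lsmul_extMul _ _ _ _
  have cf : ∀ a i j, Commute (X i j) (extCross (q : ℂ) θ A k a) :=
    fun a i j => commute_lsmul_extCross _ _ _ _ _
  have hη : ∀ j l, (-(q : ℂ)⁻¹) • (η j * η l) =
      hecke (q : ℂ) j l • (η j * η l) + θ l j • (η l * η j) := fun j l => by
    have := hXq.transport (p := fun a b => extMul (q : ℂ) θ A a * extMul (q : ℂ) θ A b)
      (r := fun a b => (-(q : ℂ)⁻¹) • (extMul (q : ℂ) θ A a * extMul (q : ℂ) θ A b))
      (fun a b => extMul_rel (q : ℂ) θ A hq' hθ a b) j l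
    simp only [smul_mul_assoc, ← smul_sum] at this
    simp only [hηdef, sum_mul_sum_of_commute fun a b => cη b a _]
    exact this
  have hf : ∀ j l, η j * f l = hecke (q : ℂ) j l • (f j * η l) + θ l j • (f l * η j) :=
    fun j l => by
      have := hXq.transport (p := fun a b => extCross (q : ℂ) θ A k a * extMul (q : ℂ) θ A b)
        (r := fun a b => extMul (q : ℂ) θ A a * extCross (q : ℂ) θ A k b)
        (fun a b => extMul_mul_extCross (q : ℂ) θ A hq' hd hθ k a b) j l
      simp only [hηdef, hfdef, sum_mul_sum_of_commute fun a b => cη b a _,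
        sum_mul_sum_of_commute fun a b => cf b a _]
      exact this
  have main := cross_mul_prod hq' hd hθ (ext_mul_self hq' hq2 hd hη)
    (fun j l h => ext_mul_comm hq' hη h) hf l (List.finRange n)
    (List.pairwise_lt_finRange n) (List.mem_finRange l)
  rw [← List.ofFn_eq_map] at main
  have e := congrFun (LinearMap.congr_fun main (Pi.single ∅ 1)) univ
  have hfs : f l (Pi.single ∅ 1) = Pi.single ∅ (V k l) := by
    have hs : ∀ a, X a l (Pi.single ∅ 1) = Pi.single ∅ (V a l) := fun a => by
      ext S
      by_cases hS : S = ∅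
      · subst hS
        simp [hX]
      · simp [hX, hS]
    simp [hfdef, hs, extCross_single_empty]
  have hfu : ∀ w : Finset (Fin n) → A,
      f l w univ = ((q : ℂ)⁻¹ * ∏ s, θ s k) • (V k l * w univ) := fun w => by
    simp [hfdef, extCross_univ, hX]
  rw [LinearMap.smul_apply, Pi.smul_apply, Module.End.mul_apply, Module.End.mul_apply, hfs, hfu,
    prod_ext_univ, prod_ext_univ, mul_one] at e
  have e2 := congrArg (fun z => (q : ℂ) • z) e
  simp only [smul_smul, mul_inv_cancel_left₀ hq'] at e2
  rw [e2]
  rw [← List.ofFn_eq_map, List.prod_ofFn]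

end Normal

/-! ### Quantum matrices from `q`-oscillators -/

section Oscillator

variable {ι : Type*} [LinearOrder ι] {B : Type*} [Ring B] [Algebra ℂ B]

/-- A family of `q`-oscillators with creation operators `y`, annihilation operators `D` and
diagonal operators `K`; different oscillators commute up to powers of `q`. -/
structure IsOscillator (q : ℂ) (y D K : ι → B) : Prop where
  yy : ∀ j l, j < l → y j * y l = q • (y l * y j)
  DD : ∀ j l, j < l → D j * D l = q • (D l * D j)
  Dy_lt : ∀ j l, j < l → D j * y l = q⁻¹ • (y l * D j)
  Dy_gt : ∀ j l, j < l → D l * y j = q • (y j * D l)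
  Dy : ∀ j, D j * y j = q⁻¹ • (y j * D j) + (q - q⁻¹) • K j
  KK : ∀ j l, K j * K l = K l * K j
  Ky : ∀ j l, j ≠ l → K j * y l = y l * K j
  Ky_self : ∀ j, K j * y j = q • (y j * K j)
  DK : ∀ j l, j ≠ l → D j * K l = K l * D j
  DK_self : ∀ j, D j * K j = q • (K j * D j)

/-- The lower triangular matrix with diagonal entries `K j` and entries `y j * D a` below the
diagonal. -/
def oscMatrix {B : Type*} [Ring B] (y D K : ι → B) (a j : ι) : B :=
  if j = a then K a else if j < a then y j * D a else 0

theorem oscMatrix_self {B : Type*} [Ring B] (y D K : ι → B) (a : ι) :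
    oscMatrix y D K a a = K a := by simp [oscMatrix]

theorem oscMatrix_of_lt {B : Type*} [Ring B] (y D K : ι → B) {a j : ι} (h : j < a) :
    oscMatrix y D K a j = y j * D a := by simp [oscMatrix, h, h.ne]

theorem oscMatrix_of_gt {B : Type*} [Ring B] (y D K : ι → B) {a j : ι} (h : a < j) :
    oscMatrix y D K a j = 0 := by simp [oscMatrix, h.not_gt, h.ne']

theorem mul_mul_mul_comm_of {u v w z : B} {c : ℂ} (h : v * w = c • (w * v)) :
    u * v * (w * z) = c • (u * w * (v * z)) := by
  rw [mul_assoc, ← mul_assoc v, h, smul_mul_assoc, mul_smul_comm]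
  simp only [mul_assoc]

/-- The triangular matrix of a family of oscillators is a quantum matrix without twist. -/
theorem IsOscillator.isQuantum {q : ℂ} (hq : q ≠ 0) {y D K : ι → B} (h : IsOscillator q y D K) :
    IsQuantum q (fun _ _ => 1) (fun _ _ => 1) (oscMatrix y D K) := by
  have hyy' : ∀ j l, j < l → y l * y j = q⁻¹ • (y j * y l) := fun j l hjl => by
    rw [h.yy j l hjl, smul_smul, inv_mul_cancel₀ hq, one_smul]
  refine .of_rel hq (by simp) (by simp) (by simp) (by simp) ?_ ?_ ?_ ?_
  · intro a j l hjl
    rw [mul_one]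
    rcases lt_trichotomy a l with hl | rfl | hl
    · simp [oscMatrix_of_gt _ _ _ hl]
    · rw [oscMatrix_self, oscMatrix_of_lt _ _ _ hjl, mul_assoc, h.DK_self, mul_smul_comm,
        ← mul_assoc, ← mul_assoc, h.Ky _ _ hjl.ne']
    · rw [oscMatrix_of_lt _ _ _ hl, oscMatrix_of_lt _ _ _ (hjl.trans hl),
        mul_mul_mul_comm_of (h.Dy_gt _ _ hl), mul_mul_mul_comm_of (h.Dy_gt _ _ (hjl.trans hl)),
        h.yy _ _ hjl, smul_mul_assoc]
  · intro a b j hab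
    rw [mul_one]
    rcases lt_trichotomy a j with hj | rfl | hj
    · simp [oscMatrix_of_gt _ _ _ hj]
    · rw [oscMatrix_self, oscMatrix_of_lt _ _ _ hab, ← mul_assoc, h.Ky_self, smul_mul_assoc,
        mul_assoc, mul_assoc, h.DK _ _ hab.ne']
    · rw [oscMatrix_of_lt _ _ _ hj, oscMatrix_of_lt _ _ _ (hj.trans hab),
        mul_mul_mul_comm_of (h.Dy_gt _ _ hj), mul_mul_mul_comm_of (h.Dy_gt _ _ (hj.trans hab)),
        h.DD _ _ hab, mul_smul_comm]
  · intro a b j l hab hjl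
    rw [one_smul, one_smul]
    rcases lt_trichotomy a l with hl | rfl | hl
    · simp [oscMatrix_of_gt _ _ _ hl]
    · rw [oscMatrix_self, oscMatrix_of_lt _ _ _ (hjl.trans hab), ← mul_assoc, h.Ky _ _ hjl.ne',
        mul_assoc, mul_assoc, h.DK _ _ hab.ne']
    · rw [oscMatrix_of_lt _ _ _ hl, oscMatrix_of_lt _ _ _ (hjl.trans (hl.trans hab)),
        mul_mul_mul_comm_of (h.Dy_gt _ _ (hjl.trans hl)),
        mul_mul_mul_comm_of (h.Dy_gt _ _ (hl.trans hab)), h.DD _ _ hab, hyy' _ _ hjl,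
        smul_mul_assoc, mul_smul_comm, smul_smul, mul_inv_cancel₀ hq, one_smul]
  · intro a b j l hab hjl
    rw [one_smul, one_smul]
    rcases lt_trichotomy a j with hj | rfl | hj
    · simp [oscMatrix_of_gt _ _ _ hj, oscMatrix_of_gt _ _ _ (hj.trans hjl)]
    · rw [oscMatrix_of_gt _ _ _ hjl, zero_mul, smul_zero, add_zero, oscMatrix_self]
      rcases lt_trichotomy b l with hb | rfl | hb
      · simp [oscMatrix_of_gt _ _ _ hb]
      · rw [oscMatrix_self, h.KK]
      · rw [oscMatrix_of_lt _ _ _ hb, ← mul_assoc, h.Ky _ _ hjl.ne, mul_assoc, mul_assoc,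
          h.DK _ _ hab.ne']
    · rw [oscMatrix_of_lt _ _ _ hj, oscMatrix_of_lt _ _ _ (hj.trans hab)]
      rcases lt_trichotomy a l with hl | rfl | hl
      · rw [oscMatrix_of_gt _ _ _ hl, zero_mul, smul_zero, add_zero]
        rcases lt_trichotomy b l with hb | rfl | hb
        · simp [oscMatrix_of_gt _ _ _ hb]
        · rw [oscMatrix_self, mul_assoc, h.DK _ _ hab.ne, ← mul_assoc, ← mul_assoc,
            h.Ky _ _ (hj.trans hab).ne']
        · rw [oscMatrix_of_lt _ _ _ hb, mul_mul_mul_comm_of (h.Dy_lt _ _ hl),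
            mul_mul_mul_comm_of (h.Dy_gt _ _ (hj.trans hab)), h.yy _ _ hjl, h.DD _ _ hab]
          simp only [smul_mul_assoc, mul_smul_comm, smul_smul]
          congr 1
          field_simp
      · rw [oscMatrix_self, oscMatrix_of_lt _ _ _ hab, ← mul_assoc (K a), h.Ky _ _ hj.ne',
          mul_mul_mul_comm_of (h.Dy_gt _ _ (hj.trans hab)), mul_assoc (y j), ← mul_assoc (D a),
          h.Dy, hyy' _ _ hj, add_mul, mul_add]
        simp only [smul_mul_assoc, mul_smul_comm, smul_smul, mul_assoc, h.DD _ _ hab]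
        match_scalars
        · field_simp
        · ring
      · rw [oscMatrix_of_lt _ _ _ hl, oscMatrix_of_lt _ _ _ (hl.trans hab),
          mul_mul_mul_comm_of (h.Dy_gt _ _ hl),
          mul_mul_mul_comm_of (h.Dy_gt _ _ (hj.trans hab)),
          mul_mul_mul_comm_of (h.Dy_gt _ _ hj), h.yy _ _ hjl, h.DD _ _ hab]
        simp only [smul_mul_assoc, mul_smul_comm, smul_smul, ← add_smul]
        congr 1
        field_simp
        ring

end Oscillator

/-! ### Weighted shift operators -/

section Shift

variable {G M : Type*} [AddCommGroup G] [AddCommGroup M] [Module ℂ M]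

/-- The operator on `G →₀ M` that maps `single g v` to `single (g + d) (c g • f v)`. -/
noncomputable def shiftOp (d : G) (c : G → ℂ) (f : Module.End ℂ M) : Module.End ℂ (G →₀ M) :=
  Finsupp.lsum ℂ fun g => c g • (Finsupp.lsingle (g + d) ∘ₗ f)

@[simp] theorem shiftOp_single (d : G) (c : G → ℂ) (f : Module.End ℂ M) (g : G) (v : M) :
    shiftOp d c f (Finsupp.single g v) = Finsupp.single (g + d) (c g • f v) := by
  simp [shiftOp]

theorem shiftOp_mul (d d' : G) (c c' : G → ℂ) (f f' : Module.End ℂ M) :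
    shiftOp d c f * shiftOp d' c' f' = shiftOp (d' + d) (fun g => c' g * c (g + d')) (f * f') := by
  refine Finsupp.lhom_ext fun g v => ?_
  simp [smul_smul, add_assoc, mul_comm]

theorem smul_shiftOp (a : ℂ) (d : G) (c : G → ℂ) (f : Module.End ℂ M) :
    a • shiftOp d c f = shiftOp d (fun g => a * c g) f := by
  refine Finsupp.lhom_ext fun g v => ?_
  simp [smul_smul]

theorem shiftOp_add (d : G) (c c' : G → ℂ) (f : Module.End ℂ M) :
    shiftOp d c f + shiftOp d c' f = shiftOp d (fun g => c g + c' g) f := by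
  refine Finsupp.lhom_ext fun g v => ?_
  simp [add_smul]

end Shift

section OscillatorRep

variable {ι : Type*} [LinearOrder ι] [Fintype ι] (q : ℂ) (ε : ι → ℂ) (M : Type*) [AddCommGroup M]
  [Module ℂ M]

/-- The sum of the entries of `α` behind the `j`-th one. -/
def tailSum (j : ι) (α : ι → ℤ) : ℤ := ∑ l with j < l, α l

theorem tailSum_add (j : ι) (α β : ι → ℤ) : tailSum j (α + β) = tailSum j α + tailSum j β := by
  simp [tailSum, sum_add_distrib]

theorem tailSum_neg (j : ι) (α : ι → ℤ) : tailSum j (-α) = -tailSum j α := by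
  simp [tailSum]

theorem tailSum_single (j l : ι) : tailSum j (Pi.single l 1) = if j < l then 1 else 0 := by
  simp [tailSum, Pi.single_apply]

/-- Creation operators. -/
noncomputable def oscY (j : ι) : Module.End ℂ ((ι → ℤ) →₀ M) :=
  shiftOp (Pi.single j 1) (fun α => q ^ tailSum j α) 1

/-- Annihilation operators.  The relations hold for every value of `ε`; the vacuum is annihilated
for `ε l = 1`, and the operator is injective for `ε l = 0`. -/
noncomputable def oscD (l : ι) : Module.End ℂ ((ι → ℤ) →₀ M) :=
  shiftOp (-Pi.single l 1) (fun α => (q ^ α l - ε l * q ^ (-α l)) * q ^ (-tailSum l α)) 1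

/-- Diagonal operators. -/
noncomputable def oscK (j : ι) : Module.End ℂ ((ι → ℤ) →₀ M) :=
  shiftOp 0 (fun α => q ^ α j) 1

theorem isOscillator (hq : q ≠ 0) : IsOscillator q (oscY q M) (oscD q ε M) (oscK (ι := ι) q M) where
  yy j l h := by
    simp only [oscY, shiftOp_mul, smul_shiftOp, tailSum_add, tailSum_single, h, h.not_gt, if_true,
      if_false, zpow_add₀ hq]
    rw [add_comm]
    congr 1
    ext α
    simp
    ring
  DD j l h := by
    simp only [oscD, shiftOp_mul, smul_shiftOp, tailSum_add, tailSum_neg, tailSum_single, h,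
      h.not_gt, if_true, if_false, zpow_add₀ hq, Pi.add_apply, Pi.neg_apply, neg_add]
    rw [add_comm]
    congr 1
    ext α
    simp [h.ne, h.ne']
    field_simp
  Dy_lt j l h := by
    simp only [oscD, oscY, shiftOp_mul, smul_shiftOp, tailSum_add, tailSum_neg, tailSum_single, h,
      h.not_gt, if_true, if_false, zpow_add₀ hq, Pi.add_apply, neg_add]
    rw [add_comm]
    congr 1
    ext α
    simp [h.ne]
    field_simp
  Dy_gt j l h := by
    simp only [oscD, oscY, shiftOp_mul, smul_shiftOp, tailSum_add, tailSum_neg, tailSum_single, h,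
      h.not_gt, if_true, if_false, zpow_add₀ hq, Pi.add_apply, neg_add]
    rw [add_comm]
    congr 1
    ext α
    simp [h.ne']
    field_simp
  Dy j := by
    simp only [oscD, oscY, oscK, shiftOp_mul, smul_shiftOp, tailSum_add, tailSum_neg,
      tailSum_single, lt_irrefl, if_false, zpow_add₀ hq, Pi.add_apply, neg_add,
      add_neg_cancel, neg_add_cancel, mul_one, shiftOp_add]
    congr 1
    ext α
    simp
    field_simp
    ring
  KK j l := by
    simp only [oscK, shiftOp_mul, add_zero, mul_comm]
  Ky j l h := by
    simp only [oscK, oscY, shiftOp_mul, add_zero, zero_add, Pi.add_apply]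
    congr 1
    ext α
    simp [h, mul_comm]
  Ky_self j := by
    simp only [oscK, oscY, shiftOp_mul, smul_shiftOp, add_zero, zero_add, Pi.add_apply,
      zpow_add₀ hq]
    congr 1
    ext α
    simp
    ring
  DK j l h := by
    simp only [oscK, oscD, shiftOp_mul, add_zero, zero_add, Pi.add_apply]
    congr 1
    ext α
    simp [h.symm, mul_comm]
  DK_self j := by
    simp only [oscK, oscD, shiftOp_mul, smul_shiftOp, add_zero, zero_add, Pi.add_apply,
      zpow_add₀ hq]
    congr 1
    ext α
    simp
    field_simp

end OscillatorRep

/-- The product of the powers `V_p ^ m p`, taken in the order of the list `L`. -/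
def monomial {ι κ A : Type*} [Monoid A] (V : ι → κ → A) (L : List (ι × κ)) (m : ι × κ → ℕ) : A :=
  (L.map fun p => V p.1 p.2 ^ m p).prod

theorem shiftOp_pow_single {G M : Type*} [AddCommGroup G] [AddCommGroup M] [Module ℂ M]
    {F : Module.End ℂ (G →₀ M)} {f : Module.End ℂ M} {d : G}
    (hF : ∀ g, ∃ c : ℂ, c ≠ 0 ∧ ∀ v, F (Finsupp.single g v) = Finsupp.single (g + d) (c • f v))
    (k : ℕ) (g : G) : ∃ c : ℂ, c ≠ 0 ∧
      ∀ v, (F ^ k) (Finsupp.single g v) = Finsupp.single (g + k • d) (c • (f ^ k) v) := by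
  induction k with
  | zero => exact ⟨1, one_ne_zero, by simp⟩
  | succ k ih =>
    obtain ⟨c, hc, h⟩ := ih
    obtain ⟨c', hc', h'⟩ := hF (g + k • d)
    refine ⟨c' * c, mul_ne_zero hc' hc, fun v => ?_⟩
    rw [pow_succ', Module.End.mul_apply, h, h', map_smul, smul_smul, add_assoc, succ_nsmul,
      pow_succ', Module.End.mul_apply]

theorem monomial_shift_single {ι κ G M : Type*} [AddCommGroup G] [AddCommGroup M] [Module ℂ M]
    {F : ι → κ → Module.End ℂ (G →₀ M)} {f : ι → κ → Module.End ℂ M} {d : ι × κ → G}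
    (hF : ∀ i j g, ∃ c : ℂ, c ≠ 0 ∧
      ∀ v, F i j (Finsupp.single g v) = Finsupp.single (g + d (i, j)) (c • f i j v))
    (L : List (ι × κ)) (m : ι × κ → ℕ) (g : G) : ∃ c : ℂ, c ≠ 0 ∧
      ∀ v, monomial F L m (Finsupp.single g v) =
        Finsupp.single (g + (L.map fun p => m p • d p).sum) (c • monomial f L m v) := by
  induction L with
  | nil => exact ⟨1, one_ne_zero, by simp [monomial]⟩
  | cons p L ih =>
    obtain ⟨c, hc, h⟩ := ih
    obtain ⟨c', hc', h'⟩ := shiftOp_pow_single (hF p.1 p.2) (m p)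
      (g + (L.map fun p => m p • d p).sum)
    refine ⟨c' * c, mul_ne_zero hc' hc, fun v => ?_⟩
    simp only [monomial, List.map_cons, List.prod_cons, List.sum_cons, Module.End.mul_apply] at h ⊢
    rw [h, h', map_smul, smul_smul, add_assoc, add_comm (List.sum _)]

theorem monomial_single_zero {ι κ G M : Type*} [AddCommGroup G] [AddCommGroup M] [Module ℂ M]
    {F : ι → κ → Module.End ℂ (G →₀ M)} {f : ι → κ → Module.End ℂ M}
    (hF : ∀ i j v, F i j (Finsupp.single 0 v) = Finsupp.single 0 (f i j v))
    (L : List (ι × κ)) (m : ι × κ → ℕ) (v : M) :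
    monomial F L m (Finsupp.single 0 v) = Finsupp.single 0 (monomial f L m v) := by
  induction L with
  | nil => simp [monomial]
  | cons p L ih =>
    have hp : ∀ (k : ℕ) (v : M), (F p.1 p.2 ^ k) (Finsupp.single 0 v) =
        Finsupp.single 0 ((f p.1 p.2 ^ k) v) := fun k => by
      induction k with
      | zero => simp
      | succ k ihk =>
        intro v
        rw [pow_succ', Module.End.mul_apply, ihk, hF, pow_succ', Module.End.mul_apply]
    simp only [monomial, List.map_cons, List.prod_cons, Module.End.mul_apply] at ih ⊢
    rw [ih, hp]

/-! ### A faithful model of rectangular quantum matrices -/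

section Extend

variable {m n : ℕ} {A : Type*} [Ring A]

/-- The block diagonal matrix `diag(X, 1)`. -/
def blockOne (X : Fin m → Fin n → A) (i : Fin (m + 1)) (j : Fin (n + 1)) : A :=
  Fin.lastCases (motive := fun _ => A) (Fin.lastCases (motive := fun _ => A) 1 (fun _ => 0) j)
    (fun i' => Fin.lastCases (motive := fun _ => A) 0 (fun j' => X i' j') j) i

@[simp] theorem blockOne_last_last (X : Fin m → Fin n → A) :
    blockOne X (Fin.last m) (Fin.last n) = 1 := by simp [blockOne]

@[simp] theorem blockOne_last_castSucc (X : Fin m → Fin n → A) (j : Fin n) :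
    blockOne X (Fin.last m) j.castSucc = 0 := by simp [blockOne]

@[simp] theorem blockOne_castSucc_last (X : Fin m → Fin n → A) (i : Fin m) :
    blockOne X i.castSucc (Fin.last n) = 0 := by simp [blockOne]

@[simp] theorem blockOne_castSucc_castSucc (X : Fin m → Fin n → A) (i : Fin m) (j : Fin n) :
    blockOne X i.castSucc j.castSucc = X i j := by simp [blockOne]

theorem hecke_castSucc (q : ℂ) (i k : Fin n) : hecke q i.castSucc k.castSucc = hecke q i k := by
  simp [hecke]

theorem hecke_last_castSucc (q : ℂ) (i : Fin n) : hecke q (Fin.last n) i.castSucc = 0 :=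
  hecke_of_gt _ (Fin.castSucc_lt_last i)

theorem hecke_castSucc_last (q : ℂ) (i : Fin n) : hecke q i.castSucc (Fin.last n) = q - q⁻¹ :=
  hecke_of_lt _ (Fin.castSucc_lt_last i)

theorem IsQuantum.blockOne [Algebra ℂ A] {q : ℂ} {X : Fin m → Fin n → A}
    (hX : IsQuantum q (fun _ _ => 1) (fun _ _ => 1) X) :
    IsQuantum q (fun _ _ => 1) (fun _ _ => 1) (blockOne X) := by
  intro i k j l
  induction i using Fin.lastCases <;> induction k using Fin.lastCases <;>
    induction j using Fin.lastCases <;> induction l using Fin.lastCases <;>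
    simp [hecke_castSucc, hecke_last_castSucc, hecke_castSucc_last]
  simpa using hX _ _ _ _

end Extend

section LiftOp

variable {M : Type*} [AddCommGroup M] [Module ℂ M]

/-- The embedding of the operators on `M` into the operators on `G →₀ M`. -/
noncomputable def liftOp (G : Type*) [AddCommGroup G] :
    Module.End ℂ M →ₐ[ℂ] Module.End ℂ (G →₀ M) :=
  AlgHom.ofLinearMap
    { toFun := fun f => shiftOp 0 (fun _ => 1) f
      map_add' := fun f g => Finsupp.lhom_ext fun a v => by simp
      map_smul' := fun c f => Finsupp.lhom_ext fun a v => by simp }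
    (Finsupp.lhom_ext fun a v => by simp)
    (fun f g => Finsupp.lhom_ext fun a v => by simp)

theorem liftOp_single (G : Type*) [AddCommGroup G] (f : Module.End ℂ M) (g : G) (v : M) :
    liftOp G f (Finsupp.single g v) = Finsupp.single g (f v) := by
  simp [liftOp]

theorem commute_liftOp (G : Type*) [AddCommGroup G] (f : Module.End ℂ M) (d : G) (c : G → ℂ) :
    Commute (liftOp G f) (shiftOp d c 1) := by
  refine Finsupp.lhom_ext fun a v => ?_
  simp [liftOp_single]

end LiftOp

/-- The positions of an `m × n` matrix, later rows first. -/
def lexList (m n : ℕ) : List (Fin m × Fin n) :=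
  (List.finRange m).reverse.flatMap fun i => (List.finRange n).map fun j => (i, j)

theorem nodup_lexList (m n : ℕ) : (lexList m n).Nodup :=
  List.Nodup.product (List.nodup_reverse.mpr (List.nodup_finRange m)) (List.nodup_finRange n)

theorem mem_lexList {m n : ℕ} (p : Fin m × Fin n) : p ∈ lexList m n := by
  simp [lexList, Prod.ext_iff]

theorem lexList_succ (m n : ℕ) : lexList (m + 1) n =
    ((List.finRange n).map fun j => (Fin.last m, j)) ++
      (lexList m n).map fun p => (p.1.castSucc, p.2) := by
  simp only [lexList, List.finRange_succ_last, List.reverse_append, List.reverse_singleton,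
    List.singleton_append, List.flatMap_cons, ← List.map_reverse, List.flatMap_map,
    List.map_flatMap, List.map_map, Function.comp_def]

/-- For each `m × n` there is a quantum matrix (without twist) of operators and a vector to which
the ordered monomials can be applied with linearly independent results.  A row is added by
multiplying `diag(X, 1)` with the triangular matrix of `n + 1` oscillators, the last of which has
an injective annihilation operator. -/
theorem exists_model (q : ℂ) (hq : q ≠ 0) (m n : ℕ) :
    ∃ (M : Type) (_ : AddCommGroup M) (_ : Module ℂ M) (X : Fin m → Fin n → Module.End ℂ M)
      (v : M), IsQuantum q (fun _ _ => 1) (fun _ _ => 1) X ∧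
        LinearIndependent ℂ fun a : Fin m × Fin n → ℕ => monomial X (lexList m n) a v := by
  induction m with
  | zero =>
    refine ⟨ℂ, inferInstance, inferInstance, fun i => i.elim0, 1, fun i => i.elim0, ?_⟩
    rw [linearIndependent_unique_iff]
    simp [monomial, lexList]
  | succ m ih =>
    obtain ⟨M, _, _, X, v, hX, hv⟩ := ih
    set ε : Fin (n + 1) → ℂ := fun a => if a = Fin.last n then 0 else 1 with hε
    set Y := blockOne fun i j => liftOp (Fin (n + 1) → ℤ) (X i j) with hY
    set T := oscMatrix (oscY q M) (oscD q ε M) (oscK (ι := Fin (n + 1)) q M) with hT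
    have hYq : IsQuantum q (fun _ _ => 1) (fun _ _ => 1) Y := (hX.map (liftOp _)).blockOne
    have hTq : IsQuantum q (fun _ _ => 1) (fun _ _ => 1) T :=
      (isOscillator q ε M hq).isQuantum hq
    have hc : ∀ i a b j, Commute (Y i a) (T b j) := by
      intro i a b j
      have hf : ∀ f : Module.End ℂ M, Commute (liftOp (Fin (n + 1) → ℤ) f) (T b j) := fun f => by
        rw [hT, oscMatrix]
        split_ifs
        · exact commute_liftOp _ _ _ _
        · exact (commute_liftOp _ _ _ _).mul_right (commute_liftOp _ _ _ _)
        · exact Commute.zero_right _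
      induction i using Fin.lastCases <;> induction a using Fin.lastCases <;> simp [hY, hf]
    set Z : Fin (m + 1) → Fin (n + 1) → Module.End ℂ ((Fin (n + 1) → ℤ) →₀ M) :=
      fun i j => ∑ a, Y i a * T a j with hZ
    have hZq : IsQuantum q (fun _ _ => 1) (fun _ _ => 1) Z := hYq.mul hTq hc
    refine ⟨(Fin (n + 1) → ℤ) →₀ M, inferInstance, inferInstance, fun i j => Z i j.castSucc,
      Finsupp.single 0 v, fun i k j l => ?_, ?_⟩
    · simpa only [hecke_castSucc] using hZq i k j.castSucc l.castSucc
    -- the first `m` rows act on the vacuum of the oscillators as `X` does, since all annihilation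
    -- operators but the last one kill the vacuum
    have hlow : ∀ (i : Fin m) (j : Fin n) (w : M),
        Z i.castSucc j.castSucc (Finsupp.single 0 w) = Finsupp.single 0 (X i j w) := by
      intro i j w
      have hTa : ∀ a : Fin n, T a.castSucc j.castSucc (Finsupp.single 0 w) =
          if j = a then Finsupp.single 0 w else 0 := fun a => by
        rcases lt_trichotomy a j with h | rfl | h
        · rw [hT, oscMatrix_of_gt _ _ _ (Fin.castSucc_lt_castSucc_iff.mpr h), if_neg h.ne']
          rfl
        · rw [hT, oscMatrix_self]
          simp [oscK]
        · rw [hT, oscMatrix_of_lt _ _ _ (Fin.castSucc_lt_castSucc_iff.mpr h), if_neg h.ne]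
          simp [oscD, hε, Fin.castSucc_ne_last]
      simp [hZ, Fin.sum_univ_castSucc, hY, hTa, apply_ite, liftOp_single]
    -- the last row creates the new variables
    have hlast : ∀ (j : Fin n) (g : Fin (n + 1) → ℤ), ∃ c : ℂ, c ≠ 0 ∧
        ∀ w, Z (Fin.last m) j.castSucc (Finsupp.single g w) =
          Finsupp.single (g + (-Pi.single (Fin.last n) 1 + Pi.single j.castSucc 1)) (c • w) := by
      intro j g
      have hz : Z (Fin.last m) j.castSucc = oscY q M j.castSucc * oscD q ε M (Fin.last n) := by
        simp [hZ, Fin.sum_univ_castSucc, hY, hT, oscMatrix_of_lt _ _ _ (Fin.castSucc_lt_last j)]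
      refine ⟨q ^ tailSum j.castSucc (g + -Pi.single (Fin.last n) 1) *
        (q ^ g (Fin.last n) * q ^ (-tailSum (Fin.last n) g)), ?_, fun w => ?_⟩
      · exact mul_ne_zero (zpow_ne_zero _ hq) (mul_ne_zero (zpow_ne_zero _ hq) (zpow_ne_zero _ hq))
      · rw [hz, Module.End.mul_apply, oscD, shiftOp_single, oscY, shiftOp_single, add_assoc]
        simp [hε, smul_smul]
    -- the exponents of the last row can be read off from the position in the lattice
    set d : Unit × Fin n → Fin (n + 1) → ℤ :=
      fun p => -Pi.single (Fin.last n) 1 + Pi.single p.2.castSucc 1 with hd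
    set L : List (Unit × Fin n) := (List.finRange n).map fun j => ((), j) with hL
    set δ : (Fin (m + 1) × Fin n → ℕ) → Fin (n + 1) → ℤ :=
      fun a => (L.map fun p => a (Fin.last m, p.2) • d p).sum with hδ
    have hδa : ∀ a j, δ a (Fin.castSucc j) = a (Fin.last m, j) := fun a j => by
      simp only [hδ, hL, List.map_map, Function.comp_def, ← Fin.sum_univ_def]
      simp [hd, Pi.single_apply, Fin.castSucc_ne_last]
    have key : ∀ a : Fin (m + 1) × Fin n → ℕ, ∃ c : ℂ, c ≠ 0 ∧
        monomial (fun i j => Z i (Fin.castSucc j)) (lexList (m + 1) n) a (Finsupp.single 0 v) =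
          c • Finsupp.single (δ a)
            (monomial X (lexList m n) (fun p => a (p.1.castSucc, p.2)) v) := fun a => by
      obtain ⟨c, hc0, hcv⟩ := monomial_shift_single
        (F := fun (_ : Unit) j => Z (Fin.last m) (Fin.castSucc j)) (f := fun _ _ => 1) (d := d)
        (fun _ j g => hlast j g) L (fun p => a (Fin.last m, p.2)) 0
      refine ⟨c, hc0, ?_⟩
      have h1 := hcv (monomial X (lexList m n) (fun p => a (p.1.castSucc, p.2)) v)
      have h2 := monomial_single_zero (F := fun i j => Z (Fin.castSucc i) (Fin.castSucc j))
        (f := X) hlow (lexList m n) (fun p => a (p.1.castSucc, p.2)) v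
      rw [← h2, zero_add] at h1
      have h3 : monomial (fun (_ : Unit) (_ : Fin n) => (1 : Module.End ℂ M)) L
          (fun p => a (Fin.last m, p.2)) = 1 := by simp [monomial]
      rw [h3] at h1
      rw [Finsupp.smul_single]
      refine Eq.trans ?_ h1
      rw [← Module.End.mul_apply]
      congr 1
      simp only [monomial, lexList_succ, List.map_append, List.prod_append, List.map_map, hL]
      rfl
    choose c hc0 hcv using key
    simp only [hcv]
    have hli := (Finsupp.linearIndependent_single (R := ℂ) (ι := Fin (n + 1) → ℤ)
      (f := fun _ (a : Fin m × Fin n → ℕ) => monomial X (lexList m n) a v) fun _ => hv).comp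
      (fun a : Fin (m + 1) × Fin n → ℕ => ⟨δ a, fun p => a (p.1.castSucc, p.2)⟩) fun a b hab => by
        simp only [Sigma.mk.injEq, heq_eq_eq] at hab
        ext ⟨i, j⟩
        induction i using Fin.lastCases with
        | last =>
          have := congrFun hab.1 j.castSucc
          rw [hδa, hδa] at this
          exact_mod_cast this
        | cast i => exact congrFun hab.2 (i, j)
    exact hli.units_smul fun a => Units.mk0 (c a) (hc0 a)

/-- The cocycle whose commutator is `θ`. -/
noncomputable def halfTwist {n : ℕ} (θ : Fin n → Fin n → ℂ) (i k : Fin n) : ℂ :=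
  if i < k then θ i k else 1

theorem mul_halfTwist {n : ℕ} {θ : Fin n → Fin n → ℂ} (hd : ∀ i, θ i i = 1)
    (hθ : ∀ i j, θ i j * θ j i = 1) (i k : Fin n) :
    θ i k * halfTwist θ k i = halfTwist θ i k := by
  rcases lt_trichotomy i k with h | rfl | h
  · simp [halfTwist, h, h.not_gt]
  · simp [halfTwist, hd]
  · simp [halfTwist, h, h.not_gt, hθ]

/-- The twisted version of the model: tensoring `X i j` with `u i * v j`, where the `u i` and the
`v j` commute up to `θ`, introduces the twist. -/
theorem exists_twisted_model (q : ℂ) (hq : q ≠ 0) {n : ℕ} {θ : Fin n → Fin n → ℂ}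
    (hd : ∀ i, θ i i = 1) (hθ : ∀ i j, θ i j * θ j i = 1) :
    ∃ (M : Type) (_ : AddCommGroup M) (_ : Module ℂ M) (X : Fin n → Fin n → Module.End ℂ M)
      (v : M), IsQuantum q θ θ X ∧
        LinearIndependent ℂ fun a : Fin n × Fin n → ℕ => monomial X (lexList n n) a v := by
  obtain ⟨M, _, _, X, v, hX, hv⟩ := exists_model q hq n n
  have hr0 : ∀ i k, halfTwist θ i k ≠ 0 := fun i k => by
    unfold halfTwist
    split_ifs
    · exact left_ne_zero_of_mul_eq_one (hθ i k)
    · exact one_ne_zero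
  set d : Fin n × Fin n → (Fin n → ℤ) × (Fin n → ℤ) :=
    fun p => (Pi.single p.1 1, Pi.single p.2 1) with hdd
  set R : Fin n → (Fin n → ℤ) → ℂ := fun i α => ∏ k, halfTwist θ i k ^ α k with hR
  set C : Fin n → (Fin n → ℤ) → ℂ := fun j β => ∏ l, halfTwist θ l j ^ β l with hC
  have hRk : ∀ i α k, R i (α + Pi.single k 1) = R i α * halfTwist θ i k := fun i α k => by
    simp only [hR, Pi.add_apply, zpow_add₀ (hr0 _ _), prod_mul_distrib]
    congr 1
    rw [Finset.prod_eq_single k] <;> simp +contextual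
  have hCk : ∀ j β l, C j (β + Pi.single l 1) = C j β * halfTwist θ l j := fun j β l => by
    simp only [hC, Pi.add_apply, zpow_add₀ (hr0 _ _), prod_mul_distrib]
    congr 1
    rw [Finset.prod_eq_single l] <;> simp +contextual
  set W : Fin n → Fin n → Module.End ℂ ((Fin n → ℤ) × (Fin n → ℤ) →₀ M) :=
    fun i j => shiftOp (d (i, j)) (fun g => R i g.1 * C j g.2) (X i j) with hW
  refine ⟨_ →₀ M, inferInstance, inferInstance, W, Finsupp.single 0 v, ?_, ?_⟩
  · intro i k j l
    refine Finsupp.lhom_ext fun g w => ?_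
    have h0 := LinearMap.congr_fun (hX i k j l) w
    simp only [LinearMap.add_apply, LinearMap.smul_apply, Module.End.mul_apply, one_smul] at h0
    have h1 : g + d (k, j) + d (i, l) = g + d (k, l) + d (i, j) :=
      Prod.ext rfl (add_right_comm _ _ _)
    have h2 : g + d (i, l) + d (k, j) = g + d (k, l) + d (i, j) :=
      Prod.ext (add_right_comm _ _ _) rfl
    simp only [hW, LinearMap.add_apply, LinearMap.smul_apply, Module.End.mul_apply, shiftOp_single,
      h1, h2, Finsupp.smul_single, ← Finsupp.single_add, map_smul, smul_smul, Prod.fst_add,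
      Prod.snd_add]
    congr 1
    simp only [hdd, hRk, hCk]
    have e := congrArg (fun z => (R i g.1 * R k g.1 * C j g.2 * C l g.2 * halfTwist θ i k *
      halfTwist θ l j) • z) h0
    simp only [smul_add, smul_smul] at e
    convert e using 2
    · congr 1; ring
    · congr 1
      rw [← mul_halfTwist hd hθ i k]; ring
    · congr 1; ring
    · congr 1
      rw [← mul_halfTwist hd hθ l j]; ring
  · have hF : ∀ i j g, ∃ c : ℂ, c ≠ 0 ∧ ∀ w, W i j (Finsupp.single g w) =
        Finsupp.single (g + d (i, j)) (c • X i j w) := fun i j g =>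
      ⟨_, mul_ne_zero (prod_ne_zero_iff.mpr fun k _ => zpow_ne_zero _ (hr0 _ _))
        (prod_ne_zero_iff.mpr fun k _ => zpow_ne_zero _ (hr0 _ _)), fun w => shiftOp_single _ _ _ _ _⟩
    have key := fun a => monomial_shift_single hF (lexList n n) a 0
    choose c hc0 hcv using key
    -- forgetting the position in the lattice brings the untwisted model back
    refine LinearIndependent.of_comp (Finsupp.lsum ℂ fun _ => (LinearMap.id : M →ₗ[ℂ] M)) ?_
    have : ((Finsupp.lsum ℂ fun _ => (LinearMap.id : M →ₗ[ℂ] M)) ∘ fun a : Fin n × Fin n → ℕ =>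
        monomial W (lexList n n) a (Finsupp.single 0 v)) =
        fun a => c a • monomial X (lexList n n) a v := by
      ext a
      simp [hcv]
    rw [this]
    exact hv.units_smul fun a => Units.mk0 (c a) (hc0 a)

/-! ### Straightening words in the generators -/

section Word

variable {n : ℕ} {A : Type*} [Ring A]

/-- The product of the generators at the positions listed in `l`. -/
def word (V : Fin n → Fin n → A) (l : List (Fin n × Fin n)) : A := (l.map fun p => V p.1 p.2).prod

/-- The exponents of a word. -/
def content (l : List (Fin n × Fin n)) (p : Fin n × Fin n) : ℕ := l.count p

theorem word_append (V : Fin n → Fin n → A) (l l' : List (Fin n × Fin n)) :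
    word V (l ++ l') = word V l * word V l' := by simp [word]

theorem word_cons (V : Fin n → Fin n → A) (p : Fin n × Fin n) (l : List (Fin n × Fin n)) :
    word V (p :: l) = V p.1 p.2 * word V l := by simp [word]

theorem word_replicate (V : Fin n → Fin n → A) (p : Fin n × Fin n) (k : ℕ) :
    word V (List.replicate k p) = V p.1 p.2 ^ k := by simp [word]

theorem content_cons (p : Fin n × Fin n) (l : List (Fin n × Fin n)) :
    content (p :: l) = content l + Pi.single p 1 := by
  ext x
  by_cases h : p = x
  · subst h
    simp [content]
  · simp [content, h, Ne.symm h]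

theorem content_append (l l' : List (Fin n × Fin n)) :
    content (l ++ l') = content l + content l' := by
  ext x
  simp [content]

theorem content_perm {l l' : List (Fin n × Fin n)} (h : l.Perm l') : content l = content l' := by
  ext x
  exact h.count_eq x

/-- The word in the order of `L` with exponents `m`. -/
def sortedWord (L : List (Fin n × Fin n)) (m : Fin n × Fin n → ℕ) : List (Fin n × Fin n) :=
  L.flatMap fun p => List.replicate (m p) p

theorem word_sortedWord (V : Fin n → Fin n → A) (L : List (Fin n × Fin n))
    (m : Fin n × Fin n → ℕ) : word V (sortedWord L m) = monomial V L m := by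
  induction L with
  | nil => simp [word, sortedWord, monomial]
  | cons p L ih =>
    simp only [sortedWord, List.flatMap_cons, word_append, word_replicate, monomial,
      List.map_cons, List.prod_cons] at ih ⊢
    rw [ih]

theorem count_sortedWord {L : List (Fin n × Fin n)} (hL : L.Nodup) (m : Fin n × Fin n → ℕ)
    (x : Fin n × Fin n) : (sortedWord L m).count x = if x ∈ L then m x else 0 := by
  simp only [sortedWord, List.count_flatMap, Function.comp_def, List.count_replicate]
  rw [← List.sum_toFinset _ hL]
  split_ifs with hx
  · rw [Finset.sum_eq_single x] <;> simp +contextual [hx]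
  · refine Finset.sum_eq_zero fun p hp => ?_
    have : p ≠ x := fun h' => hx (h' ▸ List.mem_toFinset.mp hp)
    simp [this]

theorem content_sortedWord {L : List (Fin n × Fin n)} (hL : L.Nodup) (m : Fin n × Fin n → ℕ)
    (h : ∀ p, m p ≠ 0 → p ∈ L) : content (sortedWord L m) = m := by
  ext x
  rw [content, count_sortedWord hL]
  split_ifs with hx
  · rfl
  · by_contra h0
    exact hx (h x (Ne.symm h0))

theorem perm_sortedWord {L : List (Fin n × Fin n)} (hL : L.Nodup) (l : List (Fin n × Fin n))
    (h : ∀ p ∈ l, p ∈ L) : l.Perm (sortedWord L (content l)) := by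
  rw [List.perm_iff_count]
  intro x
  refine (congrFun (content_sortedWord hL (content l) fun p hp => h p ?_) x).symm
  exact List.count_pos_iff.mp (Nat.pos_of_ne_zero hp)

end Word

/-- A set of exponent matrices is closed under straightening if, with a pair of positions
`(i, j)`, `(k, l)`, `i < k`, `j < l`, replaced by `(i, l)`, `(k, j)`, it contains the new matrix. -/
def StraightClosed {n : ℕ} (Q : Set (Fin n × Fin n → ℕ)) : Prop :=
  ∀ (m : Fin n × Fin n → ℕ) (x y : Fin n × Fin n), x.1 < y.1 → x.2 < y.2 →
    m + Pi.single x 1 + Pi.single y 1 ∈ Q → m + Pi.single (x.1, y.2) 1 + Pi.single (y.1, x.2) 1 ∈ Q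

/-- The weight `∑ i * j` of a word; it drops under straightening. -/
def crossWeight {n : ℕ} (l : List (Fin n × Fin n)) : ℕ := (l.map fun p => p.1.val * p.2.val).sum

section Straighten

variable {n : ℕ} {q : ℂ} {θ : Fin n → Fin n → ℂ} {A : Type*} [Ring A] [Algebra ℂ A]
  {V : Fin n → Fin n → A}

theorem sub_hecke_ne_zero {ι : Type*} [LinearOrder ι] (hq : q ≠ 0) (a b : ι) :
    q - hecke q a b ≠ 0 := by
  rcases lt_trichotomy a b with h | rfl | h
  · simp [hecke_of_lt _ h, hq]
  · simp
  · simp [hecke_of_gt _ h, hq]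

/-- Two generators commute up to a scalar and a correction, which occurs only for positions that
are strictly ordered in both coordinates. -/
theorem IsQuantum.swap (hq : q ≠ 0) (hd : ∀ i, θ i i = 1) (hθ : ∀ i j, θ i j * θ j i = 1)
    (hV : IsQuantum q θ θ V) (x y : Fin n × Fin n) : ∃ c c' : ℂ, c ≠ 0 ∧
      V x.1 x.2 * V y.1 y.2 = c • (V y.1 y.2 * V x.1 x.2) + c' • (V x.1 y.2 * V y.1 x.2) ∧
      (c' ≠ 0 → (x.1 < y.1 ∧ x.2 < y.2) ∨ (y.1 < x.1 ∧ y.2 < x.2)) := by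
  obtain ⟨i, l⟩ := x
  obtain ⟨k, j⟩ := y
  have h := hV i k j l
  have hθ0 : ∀ i j, θ i j ≠ 0 := fun i j => left_ne_zero_of_mul_eq_one (hθ i j)
  dsimp only
  by_cases hik : i = k
  · subst hik
    refine ⟨θ j l * (q - hecke q j l), 0, mul_ne_zero (hθ0 _ _) (sub_hecke_ne_zero hq _ _), ?_,
      by simp⟩
    rw [hecke_self, hd] at h
    have h2 : θ l j • (V i l * V i j) = (q - hecke q j l) • (V i j * V i l) := by
      rw [eq_sub_of_add_eq' h.symm]
      module
    rw [mul_smul, ← h2, smul_smul, hθ]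
    simp
  by_cases hjl : j = l
  · subst hjl
    refine ⟨(q - hecke q i k)⁻¹ * θ i k, 0,
      mul_ne_zero (inv_ne_zero (sub_hecke_ne_zero hq _ _)) (hθ0 _ _), ?_, by simp⟩
    rw [hecke_self, hd] at h
    have h2 : θ i k • (V k j * V i j) = (q - hecke q i k) • (V i j * V k j) := by
      rw [eq_sub_of_add_eq' h]
      module
    rw [mul_smul, h2, smul_smul, inv_mul_cancel₀ (sub_hecke_ne_zero hq _ _)]
    simp
  refine ⟨θ j l * θ i k, θ j l * (hecke q i k - hecke q j l), mul_ne_zero (hθ0 _ _) (hθ0 _ _), ?_,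
    ?_⟩
  · have h2 : θ l j • (V i l * V k j) =
        θ i k • (V k j * V i l) + (hecke q i k - hecke q j l) • (V i j * V k l) := by
      rw [← sub_eq_iff_eq_add'] at h
      rw [← h]
      module
    rw [mul_smul, mul_smul, ← smul_add, ← h2, smul_smul, hθ, one_smul]
  · intro hc
    rcases lt_or_gt_of_ne hik with h1 | h1 <;> rcases lt_or_gt_of_ne hjl with h2 | h2
    · simp [hecke_of_lt _ h1, hecke_of_lt _ h2] at hc
    · exact Or.inl ⟨h1, h2⟩
    · exact Or.inr ⟨h1, h2⟩
    · simp [hecke_of_gt _ h1, hecke_of_gt _ h2] at hc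

theorem mul_add_mul_lt_of_lt {a b c d : ℕ} (h₁ : a < c) (h₂ : b < d) :
    a * d + c * b < a * b + c * d := by
  obtain ⟨e, rfl⟩ := Nat.exists_eq_add_of_lt h₁
  obtain ⟨f, rfl⟩ := Nat.exists_eq_add_of_lt h₂
  nlinarith

/-- Every word with exponents in a set closed under straightening is a combination of ordered
monomials with exponents in this set, whatever the order. -/
theorem IsQuantum.word_mem_span (hq : q ≠ 0) (hd : ∀ i, θ i i = 1)
    (hθ : ∀ i j, θ i j * θ j i = 1) (hV : IsQuantum q θ θ V) {Q : Set (Fin n × Fin n → ℕ)}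
    (hQ : StraightClosed Q) {L : List (Fin n × Fin n)} (hL : L.Nodup) (hL' : ∀ p, p ∈ L)
    (l : List (Fin n × Fin n)) (hl : content l ∈ Q) :
    word V l ∈ Submodule.span ℂ (monomial V L '' Q) := by
  induction hN : crossWeight l using Nat.strong_induction_on generalizing l with
  | _ N IH =>
  subst hN
  set S := Submodule.span ℂ (monomial V L '' Q) with hS
  -- reordering changes a word by a scalar and by words of lower weight
  have key : ∀ l₁ l₂ : List (Fin n × Fin n), l₁.Perm l₂ → ∀ pre : List (Fin n × Fin n),
      crossWeight (pre ++ l₁) = crossWeight l → content (pre ++ l₁) ∈ Q →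
      word V (pre ++ l₂) ∈ S → word V (pre ++ l₁) ∈ S := by
    intro l₁ l₂ h
    induction h with
    | nil => exact fun _ _ _ h => h
    | @cons x l₁ l₂ _ ih =>
      intro pre h1 h2 h3
      have e : ∀ l : List (Fin n × Fin n), pre ++ x :: l = (pre ++ [x]) ++ l := by simp
      rw [e] at h1 h2 h3 ⊢
      exact ih _ h1 h2 h3
    | swap y x l' =>
      intro pre h1 h2 h3
      obtain ⟨c, c', hc, hxy, hc'⟩ := hV.swap hq hd hθ x y
      have e : word V (pre ++ x :: y :: l') = c • word V (pre ++ y :: x :: l') +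
          c' • word V (pre ++ (x.1, y.2) :: (y.1, x.2) :: l') := by
        simp only [word_append, word_cons]
        rw [← mul_assoc (V x.1 x.2), hxy]
        simp only [add_mul, mul_add, smul_mul_assoc, mul_smul_comm, mul_assoc]
      rw [e]
      refine S.add_mem (S.smul_mem c h3) ?_
      by_cases hc0 : c' = 0
      · simp [hc0]
      have hm : ∀ u v : Fin n × Fin n, content (pre ++ u :: v :: l') =
          content pre + content l' + Pi.single v 1 + Pi.single u 1 := fun u v => by
        rw [content_append, content_cons, content_cons]
        abel
      rw [hm, add_right_comm] at h2
      refine S.smul_mem c' (IH _ ?_ _ ?_ rfl)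
      · rw [← h1]
        have : x.1.val * y.2.val + y.1.val * x.2.val < x.1.val * x.2.val + y.1.val * y.2.val := by
          rcases hc' hc0 with ⟨h5, h6⟩ | ⟨h5, h6⟩
          · exact mul_add_mul_lt_of_lt h5 h6
          · have := mul_add_mul_lt_of_lt (Fin.lt_def.mp h5) (Fin.lt_def.mp h6)
            omega
        simp only [crossWeight, List.map_append, List.map_cons, List.sum_append, List.sum_cons]
        omega
      · rw [hm]
        rcases hc' hc0 with ⟨h5, h6⟩ | ⟨h5, h6⟩
        · rw [add_right_comm]
          exact hQ _ x y h5 h6 h2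
        · rw [add_right_comm] at h2
          exact hQ _ y x h5 h6 h2
    | @trans l₁ l₂ l₃ h₁ h₂ ih₁ ih₂ =>
      intro pre h1 h2 h3
      have hp := h₁.append_left pre
      refine ih₁ pre h1 h2 (ih₂ pre ?_ ?_ h3)
      · rw [← h1]
        exact ((hp.map _).sum_eq).symm
      · rwa [← content_perm hp]
  refine key _ _ (perm_sortedWord hL l fun p _ => hL' p) [] rfl hl ?_
  rw [List.nil_append, word_sortedWord]
  exact Submodule.subset_span ⟨_, hl, rfl⟩

end Straighten

/-! ### The ordered monomials form a basis -/

/-- In a space with a graded basis whose homogeneous parts are finite, a spanning family with the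
same index set and the same degrees is linearly independent. -/
theorem linearIndependent_of_graded_span {ι E : Type*} [AddCommGroup E] [Module ℂ E]
    (b : Module.Basis ι ℂ E) (d : ι → ℕ) (hfin : ∀ e, {i | d i = e}.Finite) (v : ι → E)
    (hv : ∀ i, v i ∈ Submodule.span ℂ (b '' {j | d j = d i}))
    (hspan : Submodule.span ℂ (Set.range v) = ⊤) : LinearIndependent ℂ v := by
  -- `Φ` sends the basis to the family; it is surjective and preserves the finite-dimensional
  -- homogeneous parts `W e`, hence is injective on each of them
  set Φ : E →ₗ[ℂ] E := b.constr ℂ v with hΦ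
  have hΦb : ∀ i, Φ (b i) = v i := fun i => b.constr_basis ℂ v i
  set W : ℕ → Submodule ℂ E := fun e => Submodule.span ℂ (b '' {j | d j = e}) with hW
  set π : ℕ → E →ₗ[ℂ] E := fun e => b.constr ℂ fun i => if d i = e then b i else 0 with hπ
  have hπb : ∀ e i, π e (b i) = if d i = e then b i else 0 := fun e i => b.constr_basis ℂ _ i
  have hπW : ∀ e x, π e x ∈ W e := fun e x => by
    have hx : x ∈ Submodule.span ℂ (Set.range b) := b.mem_span x
    induction hx using Submodule.span_induction with
    | mem x hx =>
      obtain ⟨i, rfl⟩ := hx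
      rw [hπb]
      split_ifs with h
      · exact Submodule.subset_span ⟨i, h, rfl⟩
      · exact zero_mem _
    | zero => simp
    | add x y _ _ hx hy => rw [map_add]; exact add_mem hx hy
    | smul c x _ hx => rw [map_smul]; exact Submodule.smul_mem _ _ hx
  have hπ_eq : ∀ e e' x, x ∈ W e' → π e x = if e' = e then x else 0 := fun e e' x hx => by
    induction hx using Submodule.span_induction with
    | mem x hx =>
      obtain ⟨i, rfl, rfl⟩ := hx
      exact hπb e i
    | zero => simp
    | add x y _ _ hx hy => rw [map_add, hx, hy]; split_ifs <;> simp
    | smul c x _ hx => rw [map_smul, hx]; split_ifs <;> simp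
  have hcomm : ∀ e x, Φ (π e x) = π e (Φ x) := fun e => by
    refine LinearMap.congr_fun (f := Φ ∘ₗ π e) (g := π e ∘ₗ Φ) (b.ext fun i => ?_)
    simp only [LinearMap.comp_apply, hπb, hΦb]
    rw [hπ_eq e (d i) (v i) (hv i), apply_ite Φ, hΦb, map_zero]
  have hsurj : Function.Surjective Φ := by
    rw [← LinearMap.range_eq_top, hΦ, b.constr_range, hspan]
  have hker : ∀ e x, x ∈ W e → Φ x = 0 → x = 0 := fun e x hx h0 => by
    have hmaps : ∀ y ∈ W e, Φ y ∈ W e := fun y hy => by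
      have := hπ_eq e e y hy
      rw [if_pos rfl] at this
      rw [← this, hcomm]
      exact hπW _ _
    have : FiniteDimensional ℂ (W e) :=
      FiniteDimensional.span_of_finite ℂ ((hfin e).image b)
    have hs : Function.Surjective (Φ.restrict hmaps) := fun ⟨w, hw⟩ => by
      obtain ⟨y, rfl⟩ := hsurj w
      refine ⟨⟨π e y, hπW e y⟩, Subtype.ext ?_⟩
      rw [LinearMap.coe_restrict_apply, hcomm, hπ_eq e e _ hw, if_pos rfl]
    have hi := LinearMap.injective_iff_surjective.mpr hs
    have := @hi ⟨x, hx⟩ 0 (Subtype.ext (by simpa using h0))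
    simpa using this
  have hΦinj : LinearMap.ker Φ = ⊥ := by
    rw [LinearMap.ker_eq_bot']
    intro x hx
    have hpx : ∀ e, π e x = 0 := fun e => hker e _ (hπW e x) (by rw [hcomm, hx, map_zero])
    refine b.ext_elem fun i => ?_
    have : ∀ y, b.coord i (π (d i) y) = b.coord i y := by
      refine LinearMap.congr_fun (f := b.coord i ∘ₗ π (d i)) (b.ext fun j => ?_)
      rw [LinearMap.comp_apply, hπb]
      split_ifs with h
      · rfl
      · have : j ≠ i := fun h' => h (h' ▸ rfl)
        simp [this]
    have h2 := this x
    rw [hpx, map_zero] at h2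
    simpa using h2.symm
  have := b.linearIndependent.map' Φ hΦinj
  rwa [show Φ ∘ b = v from funext hΦb] at this

/-- The total degree of an exponent matrix. -/
def degree {n : ℕ} (m : Fin n × Fin n → ℕ) : ℕ := ∑ p, m p

theorem degree_add {n : ℕ} (m m' : Fin n × Fin n → ℕ) :
    degree (m + m') = degree m + degree m' := by
  simp [degree, sum_add_distrib]

theorem degree_single {n : ℕ} (p : Fin n × Fin n) : degree (Pi.single p 1) = 1 := by
  simp [degree]

theorem finite_degree {n : ℕ} (e : ℕ) : {m : Fin n × Fin n → ℕ | degree m = e}.Finite := by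
  refine (Set.finite_Iic (fun _ => e)).subset fun m hm p => ?_
  rw [← (show degree m = e from hm)]
  exact single_le_sum (f := m) (fun _ _ => Nat.zero_le _) (mem_univ p)

theorem straightClosed_degree {n : ℕ} (e : ℕ) :
    StraightClosed {m : Fin n × Fin n → ℕ | degree m = e} := by
  intro m x y _ _ h
  simpa only [Set.mem_ofPred_eq, degree_add, degree_single] using h

section Generators

variable {n : ℕ} {q : ℝ} {θ : Matrix (Fin n) (Fin n) ℂ} {A B : Type*} [Ring A] [Algebra ℂ A]
  [Ring B] [Algebra ℂ B]

theorem MatrixRel.map {V : Fin n → Fin n → A} (f : A →ₐ[ℂ] B) {a b : A}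
    (h : MatrixRel q θ V a b) : MatrixRel q θ (fun i j => f (V i j)) (f a) (f b) := by
  cases h with
  | row i j l hjl => simpa only [map_mul, map_smul] using .row i j l hjl
  | col i k j hik => simpa only [map_mul, map_smul] using .col i k j hik
  | antidiag i k j l hik hjl => simpa only [map_mul, map_smul] using .antidiag i k j l hik hjl
  | diag i k j l hik hjl =>
    simpa only [map_mul, map_smul, map_sub] using .diag i k j l hik hjl

theorem MatrixRel.eq_of_map {V : Fin n → Fin n → A} (f : A →ₐ[ℂ] B)
    (hf : ∀ a b, MatrixRel q θ V a b → f a = f b) {a b : B}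
    (h : MatrixRel q θ (fun i j => f (V i j)) a b) : a = b := by
  cases h with
  | row i j l hjl => simpa only [map_mul, map_smul] using hf _ _ (.row i j l hjl)
  | col i k j hik => simpa only [map_mul, map_smul] using hf _ _ (.col i k j hik)
  | antidiag i k j l hik hjl =>
    simpa only [map_mul, map_smul] using hf _ _ (.antidiag i k j l hik hjl)
  | diag i k j l hik hjl =>
    simpa only [map_mul, map_smul, map_sub] using hf _ _ (.diag i k j l hik hjl)

theorem QMat.isQuantum (hq : q ≠ 0) (hd : ∀ i, θ i i = 1) (hθ : ∀ i j, θ i j * θ j i = 1) :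
    IsQuantum (q : ℂ) θ θ (QMat.V q θ) :=
  .of_matrixRel hq hd hθ fun _ _ h =>
    h.eq_of_map (RingQuot.mkAlgHom ℂ (MatrixRel q θ (freeV n))) fun _ _ h =>
      RingQuot.mkAlgHom_rel ℂ h

/-- The homomorphism out of `𝒜_{q,Θ}(n)` given by a quantum matrix. -/
noncomputable def QMat.lift (hq : q ≠ 0) (hd : ∀ i, θ i i = 1) (X : Fin n → Fin n → B)
    (hX : IsQuantum (q : ℂ) θ θ X) : QMat n q θ →ₐ[ℂ] B :=
  RingQuot.liftAlgHom ℂ ⟨FreeAlgebra.lift ℂ fun p => X p.1 p.2, fun _ _ h =>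
    hX.matrixRel hq hd (by simpa [freeV] using h.map (FreeAlgebra.lift ℂ fun p => X p.1 p.2))⟩

theorem QMat.lift_V (hq : q ≠ 0) (hd : ∀ i, θ i i = 1) (X : Fin n → Fin n → B)
    (hX : IsQuantum (q : ℂ) θ θ X) (i j : Fin n) :
    QMat.lift hq hd X hX (QMat.V q θ i j) = X i j := by
  simp [QMat.lift, QMat.V, freeV]

theorem QMat.span_word : Submodule.span ℂ (Set.range (word (QMat.V q θ))) = ⊤ := by
  rw [eq_top_iff]
  rintro x -
  obtain ⟨x, rfl⟩ := RingQuot.mkAlgHom_surjective ℂ (MatrixRel q θ (freeV n)) x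
  have hx : x ∈ Algebra.adjoin ℂ (Set.range (FreeAlgebra.ι ℂ (X := Fin n × Fin n))) := by
    rw [FreeAlgebra.adjoin_range_ι]
    trivial
  rw [← Subalgebra.mem_toSubmodule, Algebra.adjoin_eq_span] at hx
  induction hx using Submodule.span_induction with
  | mem x hx =>
    obtain ⟨l, hl, rfl⟩ := Submonoid.exists_list_of_mem_closure hx
    obtain ⟨l', rfl⟩ : l ∈ Set.range (List.map (FreeAlgebra.ι ℂ)) := by
      rw [Set.range_list_map]
      exact hl
    refine Submodule.subset_span ⟨l', ?_⟩
    rw [map_list_prod, List.map_map]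
    rfl
  | zero => simp
  | add x y _ _ hx hy => rw [map_add]; exact add_mem hx hy
  | smul c x _ hx => rw [map_smul]; exact Submodule.smul_mem _ _ hx

end Generators

theorem map_monomial {n : ℕ} {A B F : Type*} [Monoid A] [Monoid B] [FunLike F A B]
    [MonoidHomClass F A B] (f : F) (V : Fin n → Fin n → A)
    (L : List (Fin n × Fin n)) (m : Fin n × Fin n → ℕ) :
    f (monomial V L m) = monomial (fun i j => f (V i j)) L m := by
  simp [monomial, map_list_prod, Function.comp_def]

theorem QMat.span_monomial {n : ℕ} {q : ℝ} {θ : Matrix (Fin n) (Fin n) ℂ} (hq : q ≠ 0)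
    (hd : ∀ i, θ i i = 1) (hθ : ∀ i j, θ i j * θ j i = 1) {L : List (Fin n × Fin n)}
    (hL : L.Nodup) (hL' : ∀ p, p ∈ L) :
    Submodule.span ℂ (Set.range (monomial (QMat.V q θ) L)) = ⊤ := by
  rw [eq_top_iff, ← QMat.span_word, Submodule.span_le]
  rintro _ ⟨l, rfl⟩
  rw [← Set.image_univ]
  exact (QMat.isQuantum hq hd hθ).word_mem_span (Q := Set.univ) (by exact_mod_cast hq) hd hθ
    (fun _ _ _ _ _ _ => trivial) hL hL' l trivial

theorem QMat.linearIndependent_lexList {n : ℕ} {q : ℝ} {θ : Matrix (Fin n) (Fin n) ℂ} (hq : q ≠ 0)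
    (hd : ∀ i, θ i i = 1) (hθ : ∀ i j, θ i j * θ j i = 1) :
    LinearIndependent ℂ (monomial (QMat.V q θ) (lexList n n)) := by
  obtain ⟨M, _, _, X, v, hX, hv⟩ := exists_twisted_model (q : ℂ) (by exact_mod_cast hq) hd hθ
  refine LinearIndependent.of_comp
    ((LinearMap.applyₗ v) ∘ₗ (QMat.lift hq hd X hX).toLinearMap) ?_
  convert hv using 2 with a
  simp only [Function.comp_apply, LinearMap.comp_apply, LinearMap.applyₗ_apply_apply,
    AlgHom.toLinearMap_apply, map_monomial, QMat.lift_V]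

/-- The monomials in any fixed order of the generators are linearly independent: they span, and
degree by degree there are as many of them as lexicographic monomials, which are independent by
the model. -/
theorem QMat.linearIndependent_monomial {n : ℕ} {q : ℝ} {θ : Matrix (Fin n) (Fin n) ℂ} (hq : q ≠ 0)
    (hd : ∀ i, θ i i = 1) (hθ : ∀ i j, θ i j * θ j i = 1) {L : List (Fin n × Fin n)}
    (hL : L.Nodup) (hL' : ∀ p, p ∈ L) :
    LinearIndependent ℂ (monomial (QMat.V q θ) L) := by
  refine linearIndependent_of_graded_span
    (Module.Basis.mk (QMat.linearIndependent_lexList hq hd hθ)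
      (QMat.span_monomial hq hd hθ (nodup_lexList n n) mem_lexList).ge)
    degree finite_degree _ (fun m => ?_) (QMat.span_monomial hq hd hθ hL hL')
  rw [Module.Basis.coe_mk, ← word_sortedWord]
  refine (QMat.isQuantum hq hd hθ).word_mem_span (by exact_mod_cast hq) hd hθ
    (straightClosed_degree _) (nodup_lexList n n) mem_lexList _ ?_
  rw [content_sortedWord hL _ fun p _ => hL' p]
  rfl

/-! ### Commutation up to a nonzero scalar -/

/-- `a` and `b` commute up to a nonzero scalar. -/
def ScalarCommute {A : Type*} [Ring A] [Algebra ℂ A] (a b : A) : Prop :=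
  ∃ c : ℂ, c ≠ 0 ∧ a * b = c • (b * a)

section ScalarCommute

variable {A : Type*} [Ring A] [Algebra ℂ A] {a b c : A}

theorem ScalarCommute.symm (h : ScalarCommute a b) : ScalarCommute b a := by
  obtain ⟨t, ht, h⟩ := h
  exact ⟨t⁻¹, inv_ne_zero ht, by rw [h, smul_smul, inv_mul_cancel₀ ht, one_smul]⟩

theorem ScalarCommute.one_right (a : A) : ScalarCommute a 1 := ⟨1, one_ne_zero, by simp⟩

theorem ScalarCommute.mul_right (h : ScalarCommute a b) (h' : ScalarCommute a c) :
    ScalarCommute a (b * c) := by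
  obtain ⟨t, ht, h⟩ := h
  obtain ⟨t', ht', h'⟩ := h'
  refine ⟨t * t', mul_ne_zero ht ht', ?_⟩
  rw [← mul_assoc, h, smul_mul_assoc, mul_assoc, h', mul_smul_comm, smul_smul, mul_assoc]

theorem ScalarCommute.pow_right (h : ScalarCommute a b) (k : ℕ) : ScalarCommute a (b ^ k) := by
  induction k with
  | zero => simpa using ScalarCommute.one_right a
  | succ k ih => rw [pow_succ]; exact ih.mul_right h

theorem ScalarCommute.word_right {n : ℕ} {V : Fin n → Fin n → A} {l : List (Fin n × Fin n)}
    (h : ∀ p ∈ l, ScalarCommute a (V p.1 p.2)) : ScalarCommute a (word V l) := by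
  induction l with
  | nil => simpa [word] using ScalarCommute.one_right a
  | cons p l ih =>
    rw [word_cons]
    exact (h p (by simp)).mul_right (ih fun p' hp' => h p' (by simp [hp']))

end ScalarCommute

section Generators

variable {n : ℕ} {A : Type*} [Ring A] [Algebra ℂ A] {V : Fin n → Fin n → A}

theorem IsQuantum.scalarCommute_qDet {q : ℝ} {θ : Fin n → Fin n → ℂ} (hq : q ≠ 0)
    (hd : ∀ i, θ i i = 1) (hθ : ∀ i j, θ i j * θ j i = 1) (hV : IsQuantum (q : ℂ) θ θ V)
    (k l : Fin n) : ScalarCommute (V k l) (qDet q θ V) := by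
  have h0 : ∀ k, ∏ s, θ s k ≠ 0 := fun k =>
    prod_ne_zero_iff.mpr fun s _ => left_ne_zero_of_mul_eq_one (hθ s k)
  refine ⟨(∏ s, θ s k)⁻¹ * ∏ s, θ s l, mul_ne_zero (inv_ne_zero (h0 k)) (h0 l), ?_⟩
  rw [mul_smul, ← hV.mul_qDet hq hd hθ, smul_smul, inv_mul_cancel₀ (h0 k), one_smul]

variable {q : ℂ} {θ : Fin n → Fin n → ℂ}

/-- Generators at positions that are not strictly ordered in both coordinates commute up to a
scalar. -/
theorem IsQuantum.scalarCommute (hq : q ≠ 0) (hd : ∀ i, θ i i = 1)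
    (hθ : ∀ i j, θ i j * θ j i = 1) (hV : IsQuantum q θ θ V) {x y : Fin n × Fin n}
    (h₁ : ¬ (x.1 < y.1 ∧ x.2 < y.2)) (h₂ : ¬ (y.1 < x.1 ∧ y.2 < x.2)) :
    ScalarCommute (V x.1 x.2) (V y.1 y.2) := by
  obtain ⟨c, c', hc, h, hc'⟩ := hV.swap hq hd hθ x y
  have : c' = 0 := by
    by_contra h0
    exact (hc' h0).elim h₁ h₂
  exact ⟨c, hc, by rw [h, this]; simp⟩

end Generators

/-! ### Low and high positions -/

/-- The positions on or above the main anti-diagonal. -/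
def IsLow {n : ℕ} (p : Fin n × Fin n) : Prop := p.1.val + p.2.val + 1 ≤ n

instance {n : ℕ} : DecidablePred (IsLow (n := n)) := fun _ => by unfold IsLow; infer_instance

/-- The total distance of the positions above the main anti-diagonal from it; positions on or below
the anti-diagonal contribute `0` by truncated subtraction. -/
def depth {n : ℕ} (m : Fin n × Fin n → ℕ) : ℕ := ∑ p, m p * (n - (p.1.val + p.2.val + 1))

section Depth

variable {n : ℕ}

theorem depth_add (m m' : Fin n × Fin n → ℕ) : depth (m + m') = depth m + depth m' := by
  simp [depth, add_mul, sum_add_distrib]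

theorem depth_single (p : Fin n × Fin n) :
    depth (Pi.single p 1) = n - (p.1.val + p.2.val + 1) := by
  rw [depth, Finset.sum_eq_single p] <;> simp +contextual

theorem depth_le (m : Fin n × Fin n → ℕ) : depth m ≤ degree m * n := by
  rw [depth, degree, sum_mul]
  exact sum_le_sum fun p _ => Nat.mul_le_mul_left _ (Nat.sub_le _ _)

theorem degree_content (l : List (Fin n × Fin n)) : degree (content l) = l.length := by
  induction l with
  | nil => simp [degree, content]
  | cons p l ih => rw [content_cons, degree_add, ih, degree_single, List.length_cons]

theorem depth_content (l : List (Fin n × Fin n)) :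
    depth (content l) = (l.map fun p => n - (p.1.val + p.2.val + 1)).sum := by
  induction l with
  | nil => simp [depth, content]
  | cons p l ih => rw [content_cons, depth_add, ih, depth_single, List.map_cons, List.sum_cons,
      add_comm]

/-- Straightening among low positions preserves the depth. -/
theorem straightClosed_low (d e : ℕ) : StraightClosed
    {m : Fin n × Fin n → ℕ | (∀ p, m p ≠ 0 → IsLow p) ∧ degree m = d ∧ depth m = e} := by
  intro m x y h1 h2 ⟨h3, h4, h5⟩
  have hx := h3 x (by simp)
  have hy := h3 y (by simp)
  simp only [degree_add, depth_add, degree_single, depth_single] at h4 h5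
  have h1' := Fin.lt_def.mp h1
  have h2' := Fin.lt_def.mp h2
  unfold IsLow at hx hy
  refine ⟨fun p hp => ?_, ?_, ?_⟩
  · by_cases hpm : m p = 0
    · simp only [Pi.add_apply, hpm, Pi.single_apply, zero_add] at hp
      unfold IsLow
      by_cases e1 : p = (x.1, y.2)
      · subst e1; dsimp only; omega
      · by_cases e2 : p = (y.1, x.2)
        · subst e2; dsimp only; omega
        · simp [e1, e2] at hp
    · exact h3 p (by simp [hpm])
  · simpa only [degree_add, degree_single] using h4
  · simp only [depth_add, depth_single]
    omega

theorem straightClosed_high (d : ℕ) : StraightClosed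
    {m : Fin n × Fin n → ℕ | (∀ p, m p ≠ 0 → ¬ IsLow p) ∧ degree m = d} := by
  intro m x y h1 h2 ⟨h3, h4⟩
  have hx := h3 x (by simp)
  have hy := h3 y (by simp)
  have h1' := Fin.lt_def.mp h1
  have h2' := Fin.lt_def.mp h2
  unfold IsLow at hx hy
  refine ⟨fun p hp => ?_, by simpa only [degree_add, degree_single] using h4⟩
  by_cases hpm : m p = 0
  · simp only [Pi.add_apply, hpm, Pi.single_apply, zero_add] at hp
    unfold IsLow
    by_cases e1 : p = (x.1, y.2)
    · subst e1; dsimp only; omega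
    · by_cases e2 : p = (y.1, x.2)
      · subst e2; dsimp only; omega
      · simp [e1, e2] at hp
  · exact h3 p (by simp [hpm])

end Depth

theorem monomial_append {n : ℕ} {A : Type*} [Ring A] (V : Fin n → Fin n → A)
    (L L' : List (Fin n × Fin n)) (m : Fin n × Fin n → ℕ) :
    monomial V (L ++ L') m = monomial V L m * monomial V L' m := by simp [monomial]

theorem monomial_congr {n : ℕ} {A : Type*} [Ring A] (V : Fin n → Fin n → A)
    {L : List (Fin n × Fin n)} {m m' : Fin n × Fin n → ℕ} (h : ∀ p ∈ L, m p = m' p) :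
    monomial V L m = monomial V L m' := by
  unfold monomial
  congr 1
  exact List.map_congr_left fun p hp => by rw [h p hp]

/-- The span of the ordered monomials of degree `d` and depth at least `e`. -/
noncomputable def depthSpan {n : ℕ} {A : Type*} [Ring A] [Algebra ℂ A] (V : Fin n → Fin n → A)
    (L : List (Fin n × Fin n)) (d e : ℕ) : Submodule ℂ A :=
  Submodule.span ℂ (monomial V L '' {m | degree m = d ∧ e ≤ depth m})

theorem depthSpan_mono {n : ℕ} {A : Type*} [Ring A] [Algebra ℂ A] (V : Fin n → Fin n → A)
    (L : List (Fin n × Fin n)) (d : ℕ) {e e' : ℕ} (h : e ≤ e') :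
    depthSpan V L d e' ≤ depthSpan V L d e :=
  Submodule.span_mono (Set.image_mono fun _ hm => ⟨hm.1, h.trans hm.2⟩)

section LowHigh

variable {n : ℕ} {q : ℂ} {θ : Fin n → Fin n → ℂ} {A : Type*} [Ring A] [Algebra ℂ A]
  {V : Fin n → Fin n → A} {L₁ L₂ : List (Fin n × Fin n)}

/-- Straightening a low word followed by a high word does not change the depth, as the two parts
can be straightened separately. -/
theorem IsQuantum.low_mul_high_mem (hq : q ≠ 0) (hd : ∀ i, θ i i = 1)
    (hθ : ∀ i j, θ i j * θ j i = 1) (hV : IsQuantum q θ θ V) (hL : (L₁ ++ L₂).Nodup)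
    (hL' : ∀ p, p ∈ L₁ ++ L₂) (hL₁ : ∀ p ∈ L₁, IsLow p) (hL₂ : ∀ p ∈ L₂, ¬ IsLow p)
    {l₁ l₂ : List (Fin n × Fin n)} (h₁ : ∀ p ∈ l₁, IsLow p) (h₂ : ∀ p ∈ l₂, ¬ IsLow p) :
    word V l₁ * word V l₂ ∈
      depthSpan V (L₁ ++ L₂) (l₁.length + l₂.length) (depth (content l₁)) := by
  have hmem : ∀ (l : List (Fin n × Fin n)) p, content l p ≠ 0 → p ∈ l := fun l p hp =>
    List.count_pos_iff.mp (Nat.pos_of_ne_zero hp)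
  have e₁ := hV.word_mem_span hq hd hθ (straightClosed_low l₁.length (depth (content l₁))) hL hL' l₁
    ⟨fun p hp => h₁ p (hmem l₁ p hp), degree_content l₁, rfl⟩
  have e₂ := hV.word_mem_span hq hd hθ (straightClosed_high l₂.length) hL hL' l₂
    ⟨fun p hp => h₂ p (hmem l₂ p hp), degree_content l₂⟩
  have e := Submodule.mul_mem_mul e₁ e₂
  rw [Submodule.span_mul_span] at e
  refine Submodule.span_mono ?_ e
  rintro _ ⟨_, ⟨m₁, ⟨a1, a2, a3⟩, rfl⟩, _, ⟨m₂, ⟨b1, b2⟩, rfl⟩, rfl⟩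
  refine ⟨m₁ + m₂, ⟨by rw [degree_add, a2, b2], ?_⟩, ?_⟩
  · rw [depth_add, a3]
    exact Nat.le_add_right _ _
  · have z₁ : ∀ p ∈ L₂, m₁ p = 0 := fun p hp => by
      by_contra h0
      exact hL₂ p hp (a1 p h0)
    have z₂ : ∀ p ∈ L₁, m₂ p = 0 := fun p hp => by
      by_contra h0
      exact b1 p h0 (hL₁ p hp)
    have u₁ : monomial V L₂ m₁ = 1 := by
      rw [monomial_congr V (m' := 0) z₁]
      simp [monomial]
    have u₂ : monomial V L₁ m₂ = 1 := by
      rw [monomial_congr V (m' := 0) z₂]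
      simp [monomial]
    simp only [monomial_append, u₁, u₂, mul_one, one_mul]
    rw [monomial_congr V (m' := m₁) (L := L₁) fun p hp => by simp [z₂ p hp],
      monomial_congr V (m' := m₂) (L := L₂) fun p hp => by simp [z₁ p hp]]

/-- A word in which high positions precede low ones only in anti-diagonal pairs is, up to a
scalar, the product of its low and its high part. -/
theorem IsQuantum.word_eq_low_mul_high (hq : q ≠ 0) (hd : ∀ i, θ i i = 1)
    (hθ : ∀ i j, θ i j * θ j i = 1) (hV : IsQuantum q θ θ V) (l : List (Fin n × Fin n))
    (hl : l.Pairwise fun x y => ¬ IsLow x → IsLow y → y.1 < x.1 ∧ x.2 < y.2) :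
    ∃ c : ℂ, c ≠ 0 ∧ word V l =
      c • (word V (l.filter fun p => IsLow p) * word V (l.filter fun p => ¬ IsLow p)) := by
  induction l with
  | nil => exact ⟨1, one_ne_zero, by simp [word]⟩
  | cons x l ih =>
    rw [List.pairwise_cons] at hl
    obtain ⟨c, hc, h⟩ := ih hl.2
    by_cases hx : IsLow x
    · refine ⟨c, hc, ?_⟩
      rw [List.filter_cons_of_pos (by simpa using hx), List.filter_cons_of_neg (by simpa using hx),
        word_cons, word_cons, h, mul_smul_comm, mul_assoc]
    · have hs : ScalarCommute (V x.1 x.2) (word V (l.filter fun p => IsLow p)) := by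
        refine .word_right fun y hy => ?_
        rw [List.mem_filter] at hy
        obtain ⟨h1, h2⟩ := hl.1 y hy.1 hx (by simpa using hy.2)
        exact hV.scalarCommute hq hd hθ (fun h' => h'.1.not_gt h1) fun h' => h'.2.not_gt h2
      obtain ⟨c', hc', h'⟩ := hs
      refine ⟨c * c', mul_ne_zero hc hc', ?_⟩
      rw [List.filter_cons_of_neg (by simpa using hx), List.filter_cons_of_pos (by simpa using hx),
        word_cons, word_cons, h, mul_smul_comm, ← mul_assoc, h', smul_mul_assoc, smul_smul,
        mul_assoc]

/-- Words in the generators of the main anti-diagonal can be reordered at the cost of a scalar. -/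
theorem IsQuantum.word_antidiag_perm (hq : q ≠ 0) (hd : ∀ i, θ i i = 1)
    (hθ : ∀ i j, θ i j * θ j i = 1) (hV : IsQuantum q θ θ V) {l l' : List (Fin n × Fin n)}
    (h : l.Perm l') (hl : ∀ p ∈ l, p.1.val + p.2.val + 1 = n) :
    ∃ c : ℂ, c ≠ 0 ∧ word V l = c • word V l' := by
  induction h with
  | nil => exact ⟨1, one_ne_zero, by simp⟩
  | @cons x l₁ l₂ _ ih =>
    obtain ⟨c, hc, h⟩ := ih fun p hp => hl p (by simp [hp])
    exact ⟨c, hc, by rw [word_cons, word_cons, h, mul_smul_comm]⟩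
  | swap y x l =>
    have hx := hl x (by simp)
    have hy := hl y (by simp)
    obtain ⟨c, hc, h⟩ : ScalarCommute (V x.1 x.2) (V y.1 y.2) :=
      hV.scalarCommute hq hd hθ (fun ⟨h1, h2⟩ => by
        rw [Fin.lt_def] at h1 h2; omega) fun ⟨h1, h2⟩ => by rw [Fin.lt_def] at h1 h2; omega
    refine ⟨c, hc, ?_⟩
    simp only [word_cons]
    rw [← mul_assoc, h, smul_mul_assoc, mul_assoc]
  | @trans l₁ l₂ l₃ h₁ _ ih₁ ih₂ =>
    obtain ⟨c, hc, h⟩ := ih₁ hl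
    obtain ⟨c', hc', h'⟩ := ih₂ fun p hp => hl p (h₁.mem_iff.mpr hp)
    exact ⟨c * c', mul_ne_zero hc hc', by rw [h, h', smul_smul]⟩

end LowHigh

/-! ### The leading term of powers of the quantum determinant -/

/-- The positions of the permutation matrix of `σ`, column by column. -/
def permList {n : ℕ} (σ : Equiv.Perm (Fin n)) : List (Fin n × Fin n) := List.ofFn fun c => (σ c, c)

section PermList

variable {n : ℕ} (σ : Equiv.Perm (Fin n))

/-- In a permutation matrix read column by column, a position on or above the anti-diagonal that
comes after one below it lies in an earlier row. -/
theorem pairwise_permList : (permList σ).Pairwise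
    fun x y => ¬ IsLow x → IsLow y → y.1 < x.1 ∧ x.2 < y.2 := by
  rw [permList, List.pairwise_ofFn]
  intro c c' hcc h1 h2
  unfold IsLow at h1 h2
  rw [Fin.lt_def] at hcc
  refine ⟨Fin.lt_def.mpr ?_, hcc⟩
  dsimp only at h1 h2 ⊢
  omega

/-- Every permutation other than the reversal has a position strictly above the anti-diagonal, so
only the anti-diagonal term of the quantum determinant has depth zero. -/
theorem depth_permList_pos (hσ : σ ≠ Fin.revPerm) :
    1 ≤ depth (content ((permList σ).filter fun p => IsLow p)) := by
  obtain ⟨c, hc⟩ : ∃ c, (σ c).val + c.val + 1 < n := by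
    by_contra! h
    refine hσ (Equiv.ext fun c => ?_)
    -- the entries of the permutation matrix lie on the anti-diagonal on average
    have h1 : ∑ c : Fin n, ((σ c).val + c.val + 1) = ∑ _c : Fin n, n := by
      have h2 : ∑ c : Fin n, (σ c).val = ∑ c : Fin n, (Fin.rev c).val :=
        (Equiv.sum_comp σ fun c => c.val).trans (Equiv.sum_comp Fin.revPerm fun c => c.val).symm
      rw [sum_add_distrib, sum_add_distrib, h2, ← sum_add_distrib, ← sum_add_distrib]
      refine sum_congr rfl fun c _ => ?_
      rw [Fin.val_rev]
      omega
    have h3 := (sum_eq_sum_iff_of_le fun c _ => h c).mp h1.symm c (mem_univ c)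
    refine Fin.ext ?_
    rw [Fin.revPerm_apply, Fin.val_rev]
    omega
  rw [depth_content]
  refine le_trans ?_ (List.single_le_sum (fun _ _ => Nat.zero_le _) _ (List.mem_map.mpr
    ⟨(σ c, c), ?_, rfl⟩))
  · dsimp only
    omega
  · rw [List.mem_filter]
    refine ⟨(List.mem_ofFn (f := fun c => (σ c, c))).mpr ⟨c, rfl⟩, ?_⟩
    simpa [IsLow] using hc.le

theorem antidiag_permList_rev {p : Fin n × Fin n} (hp : p ∈ permList (Fin.revPerm (n := n))) :
    p.1.val + p.2.val + 1 = n := by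
  obtain ⟨c, rfl⟩ := List.mem_ofFn.mp hp
  simp only [Fin.revPerm_apply, Fin.val_rev]
  omega

/-- The exponent matrix of the main anti-diagonal. -/
def antidiag (n : ℕ) (p : Fin n × Fin n) : ℕ := if p.1.val + p.2.val + 1 = n then 1 else 0

theorem content_permList_rev : content (permList (Fin.revPerm (n := n))) = antidiag n := by
  ext p
  have hnd : (permList (Fin.revPerm (n := n))).Nodup := by
    rw [permList, List.nodup_ofFn]
    exact fun c c' h => (Prod.ext_iff.mp h).2
  rw [content, antidiag]
  split_ifs with h
  · refine List.count_eq_one_of_mem hnd ((List.mem_ofFn).mpr ⟨p.2, Prod.ext (Fin.ext ?_) rfl⟩)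
    simp only [Fin.revPerm_apply, Fin.val_rev]
    omega
  · exact List.count_eq_zero.mpr fun hp => h (antidiag_permList_rev hp)

theorem length_permList : (permList σ).length = n := by simp [permList]

theorem degree_antidiag : degree (antidiag n) = n := by
  rw [← content_permList_rev, degree_content, length_permList]

theorem degree_nsmul (k : ℕ) (m : Fin n × Fin n → ℕ) : degree (k • m) = k * degree m := by
  simp [degree, mul_sum]

theorem depth_nsmul (k : ℕ) (m : Fin n × Fin n → ℕ) : depth (k • m) = k * depth m := by
  simp [depth, mul_sum, mul_assoc]

theorem depth_antidiag : depth (antidiag n) = 0 := by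
  refine sum_eq_zero fun p _ => ?_
  unfold antidiag
  split_ifs with h
  · simp [h]
  · simp

end PermList

section DetPow

variable {n : ℕ} {q : ℝ} {θ : Fin n → Fin n → ℂ} {A : Type*} [Ring A] [Algebra ℂ A]
  {V : Fin n → Fin n → A} {L₁ L₂ : List (Fin n × Fin n)}

/-- The expansion of the quantum determinant into products of a low and a high word. -/
theorem IsQuantum.qDet_eq_low_mul_high (hq : q ≠ 0) (hd : ∀ i, θ i i = 1)
    (hθ : ∀ i j, θ i j * θ j i = 1) (hV : IsQuantum (q : ℂ) θ θ V) :
    ∃ c : Equiv.Perm (Fin n) → ℂ, (∀ σ, c σ ≠ 0) ∧ qDet q θ V =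
      ∑ σ, c σ • (word V ((permList σ).filter fun p => IsLow p) *
        word V ((permList σ).filter fun p => ¬ IsLow p)) := by
  have hq' : (q : ℂ) ≠ 0 := by exact_mod_cast hq
  have h := fun σ : Equiv.Perm (Fin n) =>
    hV.word_eq_low_mul_high hq' hd hθ (permList σ) (pairwise_permList σ)
  choose c hc hcv using h
  refine ⟨fun σ => (∏ p : Fin n × Fin n with p.1 < p.2 ∧ σ p.2 < σ p.1,
    (-(q : ℂ) * θ (σ p.2) (σ p.1))) * c σ, fun σ => mul_ne_zero (prod_ne_zero_iff.mpr fun p _ =>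
      mul_ne_zero (neg_ne_zero.mpr hq') (left_ne_zero_of_mul_eq_one (hθ _ _))) (hc σ), ?_⟩
  rw [qDet_eq]
  refine sum_congr rfl fun σ _ => ?_
  rw [mul_smul, ← hcv, word, permList, List.map_ofFn]
  rfl

/-- Inserting the `k`-th power of the quantum determinant between a low and a high word inserts, up
to a scalar and terms of greater depth, the `k`-th power of its anti-diagonal term. -/
theorem IsQuantum.qDet_pow_leading (hq : q ≠ 0) (hd : ∀ i, θ i i = 1)
    (hθ : ∀ i j, θ i j * θ j i = 1) (hV : IsQuantum (q : ℂ) θ θ V) (hL : (L₁ ++ L₂).Nodup)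
    (hL' : ∀ p, p ∈ L₁ ++ L₂) (hL₁ : ∀ p ∈ L₁, IsLow p) (hL₂ : ∀ p ∈ L₂, ¬ IsLow p) (k : ℕ)
    (l₁ l₂ : List (Fin n × Fin n)) (h₁ : ∀ p ∈ l₁, IsLow p) (h₂ : ∀ p ∈ l₂, ¬ IsLow p) :
    ∃ c : ℂ, c ≠ 0 ∧ word V l₁ * qDet q θ V ^ k * word V l₂ -
      c • (word V (l₁ ++ (List.replicate k (permList Fin.revPerm)).flatten) * word V l₂) ∈
      depthSpan V (L₁ ++ L₂) (l₁.length + l₂.length + n * k) (depth (content l₁) + 1) := by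
  have hq' : (q : ℂ) ≠ 0 := by exact_mod_cast hq
  have hlowrev : ∀ p ∈ permList (Fin.revPerm (n := n)), IsLow p := fun p hp =>
    (antidiag_permList_rev hp).le
  induction k generalizing l₁ l₂ with
  | zero => exact ⟨1, one_ne_zero, by simp⟩
  | succ k ih =>
    -- the weak form of the induction hypothesis
    have weak : ∀ l₁ l₂ : List (Fin n × Fin n), (∀ p ∈ l₁, IsLow p) → (∀ p ∈ l₂, ¬ IsLow p) →
        word V l₁ * qDet q θ V ^ k * word V l₂ ∈
          depthSpan V (L₁ ++ L₂) (l₁.length + l₂.length + n * k) (depth (content l₁)) := by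
      intro l₁ l₂ h₁ h₂
      obtain ⟨c, -, hc⟩ := ih l₁ l₂ h₁ h₂
      have h3 := depthSpan_mono V (L₁ ++ L₂) (l₁.length + l₂.length + n * k)
        (Nat.le_succ (depth (content l₁))) hc
      rw [← sub_add_cancel (word V l₁ * qDet q θ V ^ k * word V l₂) (c • _)]
      refine add_mem h3 (Submodule.smul_mem _ c ?_)
      have h4 : ∀ p ∈ l₁ ++ (List.replicate k (permList Fin.revPerm)).flatten, IsLow p := by
        intro p hp
        rcases List.mem_append.mp hp with hp | hp
        · exact h₁ p hp
        · obtain ⟨l, hl, hp⟩ := List.mem_flatten.mp hp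
          rw [List.eq_of_mem_replicate hl] at hp
          exact hlowrev p hp
      have h5 := hV.low_mul_high_mem hq' hd hθ hL hL' hL₁ hL₂ h4 h₂
      have h6 : (l₁ ++ (List.replicate k (permList (Fin.revPerm (n := n)))).flatten).length +
          l₂.length = l₁.length + l₂.length + n * k := by
        simp [length_permList]
        ring
      rw [h6] at h5
      refine depthSpan_mono V _ _ ?_ h5
      rw [content_append, depth_add]
      exact Nat.le_add_right _ _
    obtain ⟨c, hc, hdet⟩ := hV.qDet_eq_low_mul_high hq hd hθ
    set P := fun σ : Equiv.Perm (Fin n) => (permList σ).filter fun p => IsLow p with hP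
    set R := fun σ : Equiv.Perm (Fin n) => (permList σ).filter fun p => ¬ IsLow p with hR
    have hPlow : ∀ σ, ∀ p ∈ P σ, IsLow p := fun σ p hp => by simpa using (List.mem_filter.mp hp).2
    have hRhigh : ∀ σ, ∀ p ∈ R σ, ¬ IsLow p := fun σ p hp => by
      simpa using (List.mem_filter.mp hp).2
    have hlen : ∀ σ, (P σ).length + (R σ).length = n := fun σ => by
      have := List.length_eq_length_filter_add (l := permList σ) (fun p => decide (IsLow p))
      rw [length_permList] at this
      simp only [hP, hR, decide_not]
      exact this.symm
    have hPrev : P Fin.revPerm = permList Fin.revPerm :=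
      List.filter_eq_self.mpr fun p hp => by simpa using hlowrev p hp
    have hRrev : R Fin.revPerm = [] :=
      List.filter_eq_nil_iff.mpr fun p hp => by simpa using hlowrev p hp
    -- the high words produced by the determinant are moved to the right
    have hcomm : ∀ σ, ScalarCommute (word V (R σ)) (qDet q θ V ^ k) := fun σ =>
      (ScalarCommute.word_right fun p _ =>
        ((hV.scalarCommute_qDet hq hd hθ p.1 p.2).pow_right k).symm).symm
    choose t ht htv using hcomm
    have expand : word V l₁ * qDet q θ V ^ (k + 1) * word V l₂ = ∑ σ, (c σ * t σ) •
        (word V (l₁ ++ P σ) * qDet q θ V ^ k * word V (R σ ++ l₂)) := by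
      calc word V l₁ * qDet q θ V ^ (k + 1) * word V l₂
          = word V l₁ * ((∑ σ, c σ • (word V (P σ) * word V (R σ))) * qDet q θ V ^ k) *
              word V l₂ := by rw [← hdet, pow_succ']
        _ = _ := by
          simp only [sum_mul, mul_sum, smul_mul_assoc, mul_smul_comm]
          refine sum_congr rfl fun σ _ => ?_
          rw [mul_assoc (word V (P σ)), htv, mul_smul_comm, mul_smul_comm, smul_mul_assoc, mul_smul,
            word_append, word_append]
          simp only [mul_assoc]
    obtain ⟨c₀, hc₀, hrev⟩ := ih (l₁ ++ permList Fin.revPerm) l₂ (fun p hp =>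
      (List.mem_append.mp hp).elim (h₁ p) (hlowrev p)) h₂
    have hl : ∀ a b : ℕ, a + b = n →
        l₁.length + l₂.length + n * (k + 1) = (l₁.length + a) + (b + l₂.length) + n * k := by
      intro a b hab
      rw [mul_add_one]
      omega
    refine ⟨c Fin.revPerm * t Fin.revPerm * c₀,
      mul_ne_zero (mul_ne_zero (hc _) (ht _)) hc₀, ?_⟩
    have hsplit : word V l₁ * qDet q θ V ^ (k + 1) * word V l₂ -
        (c Fin.revPerm * t Fin.revPerm * c₀) •
          (word V (l₁ ++ (List.replicate (k + 1) (permList Fin.revPerm)).flatten) * word V l₂) =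
        (c Fin.revPerm * t Fin.revPerm) •
          (word V (l₁ ++ permList Fin.revPerm) * qDet q θ V ^ k * word V l₂ -
            c₀ • (word V (l₁ ++ permList Fin.revPerm ++
              (List.replicate k (permList Fin.revPerm)).flatten) * word V l₂)) +
        ∑ σ ∈ univ.erase Fin.revPerm, (c σ * t σ) •
          (word V (l₁ ++ P σ) * qDet q θ V ^ k * word V (R σ ++ l₂)) := by
      rw [expand, ← add_sum_erase univ _ (mem_univ Fin.revPerm), hPrev, hRrev, List.nil_append,
        List.replicate_succ, List.flatten_cons, List.append_assoc, smul_sub, smul_smul]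
      abel
    rw [hsplit]
    refine add_mem (Submodule.smul_mem _ _ ?_) (sum_mem fun σ hσ => Submodule.smul_mem _ _ ?_)
    · rw [hl n 0 (by simp)]
      rw [List.length_append, length_permList, content_append, depth_add, content_permList_rev,
        depth_antidiag, add_zero] at hrev
      rwa [zero_add]
    · have h3 := weak (l₁ ++ P σ) (R σ ++ l₂)
        (fun p hp => (List.mem_append.mp hp).elim (h₁ p) (hPlow σ p))
        (fun p hp => (List.mem_append.mp hp).elim (hRhigh σ p) (h₂ p))
      rw [List.length_append, List.length_append, ← hl _ _ (hlen σ)] at h3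
      refine depthSpan_mono V _ _ ?_ h3
      rw [content_append, depth_add]
      exact Nat.add_le_add_left (depth_permList_pos σ (ne_of_mem_erase hσ)) _

end DetPow

section Reduced

variable {n : ℕ}

/-- Every exponent matrix is uniquely the sum of a reduced one and a multiple of the
anti-diagonal. -/
theorem bijective_reduced_add (hn : 1 ≤ n) : Function.Bijective
    fun x : ReducedExponents n × ℕ => x.1.1 + x.2 • antidiag n := by
  have ha : ∀ i : Fin n, antidiag n (i, i.rev) = 1 := fun i => by
    rw [antidiag, if_pos]
    dsimp only
    rw [Fin.val_rev]
    omega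
  constructor
  · rintro ⟨⟨m, i, hi⟩, k⟩ ⟨⟨m', i', hi'⟩, k'⟩ h
    have e := congrFun h (i, i.rev)
    have e' := congrFun h (i', i'.rev)
    simp only [Pi.add_apply, Pi.smul_apply, ha, hi, hi', smul_eq_mul, mul_one] at e e'
    have hk : k = k' := by omega
    subst hk
    have hm : m = m' := add_right_cancel h
    subst hm
    rfl
  · intro m
    have : Nonempty (Fin n) := ⟨⟨0, hn⟩⟩
    obtain ⟨i, hi⟩ := Finite.exists_min fun i : Fin n => m (i, i.rev)
    refine ⟨⟨⟨m - m (i, i.rev) • antidiag n, i, by simp [ha]⟩, m (i, i.rev)⟩, ?_⟩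
    ext ⟨a, b⟩
    simp only [Pi.add_apply, Pi.sub_apply, Pi.smul_apply, smul_eq_mul, antidiag]
    split_ifs with h
    · have hb : b = a.rev := by
        refine Fin.ext ?_
        rw [Fin.val_rev]
        omega
      have := hi a
      rw [hb]
      omega
    · omega

/-- The decomposition of `bijective_reduced_add`, as an equivalence. -/
noncomputable def reducedEquiv (hn : 1 ≤ n) : ReducedExponents n × ℕ ≃ (Fin n × Fin n → ℕ) :=
  Equiv.ofBijective _ (bijective_reduced_add hn)

variable {q : ℝ} {θ : Fin n → Fin n → ℂ} {A : Type*} [Ring A] [Algebra ℂ A]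
  {V : Fin n → Fin n → A} {L₀ L₁ L₂ : List (Fin n × Fin n)}

/-- The leading term of an ordered monomial times a power of the quantum determinant, with respect
to the depth: the exponents grow by a multiple of the anti-diagonal. The order has to list the
positions above the anti-diagonal, then those on it, then those below it. -/
theorem IsQuantum.monomial_mul_qDet_pow (hq : q ≠ 0) (hd : ∀ i, θ i i = 1)
    (hθ : ∀ i j, θ i j * θ j i = 1) (hV : IsQuantum (q : ℂ) θ θ V)
    (hL : (L₀ ++ L₁ ++ L₂).Nodup) (hL' : ∀ p, p ∈ L₀ ++ L₁ ++ L₂)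
    (hL₀ : ∀ p ∈ L₀, p.1.val + p.2.val + 1 < n) (hL₁ : ∀ p ∈ L₁, p.1.val + p.2.val + 1 = n)
    (hL₂ : ∀ p ∈ L₂, n < p.1.val + p.2.val + 1) (m : Fin n × Fin n → ℕ) (k : ℕ) :
    ∃ c : ℂ, c ≠ 0 ∧ monomial V (L₀ ++ L₁ ++ L₂) m * qDet q θ V ^ k -
      c • monomial V (L₀ ++ L₁ ++ L₂) (m + k • antidiag n) ∈
        depthSpan V (L₀ ++ L₁ ++ L₂) (degree m + n * k) (depth m + 1) := by
  have hq' : (q : ℂ) ≠ 0 := by exact_mod_cast hq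
  have hmem : ∀ (L : List (Fin n × Fin n)) p, p ∈ sortedWord L m → p ∈ L := fun L p hp => by
    obtain ⟨a, ha, hp⟩ := List.mem_flatMap.mp hp
    rwa [List.eq_of_mem_replicate hp]
  have hlow : ∀ p ∈ L₀ ++ L₁, IsLow p := fun p hp =>
    (List.mem_append.mp hp).elim (fun h => (hL₀ p h).le) fun h => (hL₁ p h).le
  have hhigh : ∀ p ∈ L₂, ¬ IsLow p := fun p hp => (hL₂ p hp).not_ge
  have happ : ∀ L L' : List (Fin n × Fin n), sortedWord (L ++ L') m =
      sortedWord L m ++ sortedWord L' m := fun L L' => by simp [sortedWord]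
  obtain ⟨c, hc, h⟩ := hV.qDet_pow_leading hq hd hθ hL hL' hlow hhigh k
    (sortedWord (L₀ ++ L₁) m) (sortedWord L₂ m) (fun p hp => hlow p (hmem _ p hp))
    (fun p hp => hhigh p (hmem _ p hp))
  have hcont : content (sortedWord (L₀ ++ L₁) m) + content (sortedWord L₂ m) = m := by
    rw [← content_append, ← happ]
    exact content_sortedWord hL m fun p _ => hL' p
  have hdeg : (sortedWord (L₀ ++ L₁) m).length + (sortedWord L₂ m).length = degree m := by
    rw [← degree_content, ← degree_content, ← degree_add, hcont]
  have hdep : depth (content (sortedWord (L₀ ++ L₁) m)) = depth m := by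
    have h0 : depth (content (sortedWord L₂ m)) = 0 := by
      rw [depth_content]
      refine List.sum_eq_zero fun x hx => ?_
      obtain ⟨p, hp, rfl⟩ := List.mem_map.mp hx
      exact Nat.sub_eq_zero_of_le (hL₂ p (hmem _ p hp)).le
    conv_rhs => rw [← hcont, depth_add, h0, add_zero]
  rw [hdeg, hdep] at h
  -- the anti-diagonal letters only have to be sorted into the anti-diagonal part of the word
  obtain ⟨c₁, hc₁, h₁⟩ := hV.word_antidiag_perm hq' hd hθ
    (l := sortedWord L₁ m ++ (List.replicate k (permList Fin.revPerm)).flatten)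
    (l' := sortedWord L₁ (m + k • antidiag n)) (by
      rw [List.perm_iff_count]
      intro x
      have hL₁' : L₁.Nodup := hL.of_append_left.of_append_right
      have hx : x ∈ L₁ ↔ x.1.val + x.2.val + 1 = n := by
        refine ⟨hL₁ x, fun hx => ?_⟩
        rcases List.mem_append.mp (hL' x) with h | h
        · exact (List.mem_append.mp h).resolve_left fun h => (hL₀ x h).ne hx
        · exact absurd hx (hL₂ x h).ne'
      have hc : (permList (Fin.revPerm (n := n))).count x = antidiag n x :=
        congrFun content_permList_rev x
      rw [List.count_append, count_sortedWord hL₁', count_sortedWord hL₁', List.count_flatten,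
        List.map_replicate, List.sum_replicate, hc]
      by_cases h : x ∈ L₁
      · simp [h]
      · simp [h, antidiag, mt hx.mpr h]) (fun p hp => by
      rcases List.mem_append.mp hp with hp | hp
      · exact hL₁ p (hmem _ p hp)
      · obtain ⟨l, hl, hp⟩ := List.mem_flatten.mp hp
        rw [List.eq_of_mem_replicate hl] at hp
        exact antidiag_permList_rev hp)
  have hlead : word V (sortedWord (L₀ ++ L₁) m ++
      (List.replicate k (permList Fin.revPerm)).flatten) * word V (sortedWord L₂ m) =
      c₁ • monomial V (L₀ ++ L₁ ++ L₂) (m + k • antidiag n) := by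
    rw [happ, List.append_assoc, word_append, h₁, mul_smul_comm, smul_mul_assoc,
      word_sortedWord, word_sortedWord, word_sortedWord, monomial_append, monomial_append,
      monomial_congr V (L := L₀) (m := m) (m' := m + k • antidiag n) fun p hp => by
        simp [antidiag, (hL₀ p hp).ne],
      monomial_congr V (L := L₂) (m := m) (m' := m + k • antidiag n) fun p hp => by
        simp [antidiag, (hL₂ p hp).ne']]
  obtain ⟨c₂, hc₂, h₂⟩ : ScalarCommute (word V (sortedWord L₂ m)) (qDet q θ V ^ k) :=
    (ScalarCommute.word_right fun p _ =>
      ((hV.scalarCommute_qDet hq hd hθ p.1 p.2).pow_right k).symm).symm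
  refine ⟨c₂ * c * c₁, mul_ne_zero (mul_ne_zero hc₂ hc) hc₁, ?_⟩
  -- the power of the determinant is moved in front of the positions below the anti-diagonal
  have hfin : monomial V (L₀ ++ L₁ ++ L₂) m * qDet q θ V ^ k -
      (c₂ * c * c₁) • monomial V (L₀ ++ L₁ ++ L₂) (m + k • antidiag n) =
      c₂ • (word V (sortedWord (L₀ ++ L₁) m) * qDet q θ V ^ k * word V (sortedWord L₂ m) -
        c • (word V (sortedWord (L₀ ++ L₁) m ++
          (List.replicate k (permList Fin.revPerm)).flatten) * word V (sortedWord L₂ m))) := by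
    rw [hlead, ← word_sortedWord V (L₀ ++ L₁ ++ L₂) m, happ, word_append, mul_assoc, h₂,
      smul_sub, mul_smul_comm, smul_smul, smul_smul]
    simp only [mul_assoc]
  rw [hfin]
  exact Submodule.smul_mem _ _ h

end Reduced

/-! ### The basis of block products and powers of the determinant -/

/-- The positions of the `s`-th anti-diagonal, by increasing row. -/
def diagList (n s : ℕ) : List (Fin n × Fin n) :=
  ((List.finRange n).product (List.finRange n)).filter fun p => p.1.val + p.2.val + 1 = s

/-- All positions, anti-diagonal by anti-diagonal. -/
def blockList (n : ℕ) : List (Fin n × Fin n) := (List.range' 1 (2 * n - 1)).flatMap (diagList n)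

section BlockList

variable {n : ℕ}

theorem mem_diagList {s : ℕ} {p : Fin n × Fin n} :
    p ∈ diagList n s ↔ p.1.val + p.2.val + 1 = s := by
  simp [diagList, List.product]

theorem nodup_blockList : (blockList n).Nodup := by
  rw [blockList, List.nodup_flatMap]
  refine ⟨fun s _ => ((List.nodup_finRange n).product (List.nodup_finRange n)).filter _, ?_⟩
  refine (List.nodup_range' (s := 1) (n := 2 * n - 1)).imp fun {s t} hst => ?_
  exact fun p hs ht => hst ((mem_diagList.mp hs).symm.trans (mem_diagList.mp ht))

theorem mem_blockList (p : Fin n × Fin n) : p ∈ blockList n := by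
  rw [blockList, List.mem_flatMap]
  refine ⟨_, ?_, mem_diagList.mpr rfl⟩
  rw [List.mem_range'_1]
  omega

theorem blockProduct_eq {A : Type*} [Ring A] (V : Fin n → Fin n → A) (m : Fin n × Fin n → ℕ) :
    blockProduct V m = monomial V (blockList n) m := by
  simp only [blockProduct, monomial, blockList, List.map_flatMap]
  rw [List.flatMap_def, List.prod_flatten, List.map_map]
  rfl

theorem blockList_eq (hn : 1 ≤ n) : blockList n =
    (List.range' 1 (n - 1)).flatMap (diagList n) ++ diagList n n ++
      (List.range' (n + 1) (n - 1)).flatMap (diagList n) := by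
  obtain ⟨k, rfl⟩ := Nat.exists_eq_add_of_le' hn
  have : List.range' 1 (2 * (k + 1) - 1) =
      List.range' 1 k ++ [k + 1] ++ List.range' (k + 1 + 1) k := by
    rw [show [k + 1] = List.range' (1 + 1 * k) 1 by simp [add_comm], List.range'_append,
      show k + 1 + 1 = 1 + 1 * (k + 1) by ring, List.range'_append]
    congr 1
    omega
  rw [blockList, this]
  simp

end BlockList

section Bhat

variable {n : ℕ} {q : ℝ} {θ : Matrix (Fin n) (Fin n) ℂ}

/-- The element of `B̂` with index `x` has a nonzero multiple of the ordered monomial with exponents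
`reducedEquiv hn x` as its leading term. -/
theorem Bhat_sub_mem (hn : 1 ≤ n) (hq : q ≠ 0) (hd : ∀ i, θ i i = 1)
    (hθ : ∀ i j, θ i j * θ j i = 1) (x : ReducedExponents n × ℕ) :
    ∃ c : ℂ, c ≠ 0 ∧ Bhat q θ x - c • monomial (QMat.V q θ) (blockList n) (reducedEquiv hn x) ∈
      depthSpan (QMat.V q θ) (blockList n) (degree (reducedEquiv hn x))
        (depth (reducedEquiv hn x) + 1) := by
  have hL := nodup_blockList (n := n)
  have hL' := mem_blockList (n := n)
  have hb := blockList_eq hn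
  rw [hb] at hL hL'
  have h := (QMat.isQuantum hq hd hθ).monomial_mul_qDet_pow hq hd hθ hL hL'
    (fun p hp => by
      obtain ⟨s, hs, hp⟩ := List.mem_flatMap.mp hp
      rw [List.mem_range'_1] at hs
      rw [mem_diagList.mp hp]
      omega)
    (fun p hp => mem_diagList.mp hp)
    (fun p hp => by
      obtain ⟨s, hs, hp⟩ := List.mem_flatMap.mp hp
      rw [List.mem_range'_1] at hs
      rw [mem_diagList.mp hp]
      omega) x.1.1 x.2
  rw [← hb] at h
  have e : reducedEquiv hn x = x.1.1 + x.2 • antidiag n := rfl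
  rw [e, degree_add, degree_nsmul, degree_antidiag, depth_add, depth_nsmul, depth_antidiag,
    mul_zero, add_zero, mul_comm x.2, Bhat, blockProduct_eq]
  exact h

/-- `B̂` spans: modulo `B̂`, every ordered monomial is a combination of monomials of the same degree
and greater depth, and the depth is bounded in each degree. -/
theorem span_Bhat (hn : 1 ≤ n) (hq : q ≠ 0) (hd : ∀ i, θ i i = 1)
    (hθ : ∀ i j, θ i j * θ j i = 1) : Submodule.span ℂ (Set.range (Bhat q θ)) = ⊤ := by
  rw [eq_top_iff, ← QMat.span_monomial hq hd hθ (nodup_blockList (n := n)) mem_blockList,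
    Submodule.span_le]
  rintro _ ⟨m, rfl⟩
  induction hN : degree m * n - depth m using Nat.strong_induction_on generalizing m with
  | _ N IH =>
  obtain ⟨x, rfl⟩ := (reducedEquiv hn).surjective m
  set m := reducedEquiv hn x with hm
  obtain ⟨c, hc, h⟩ := Bhat_sub_mem hn hq hd hθ x
  rw [← hm] at h
  have hle : depthSpan (QMat.V q θ) (blockList n) (degree m) (depth m + 1) ≤
      Submodule.span ℂ (Set.range (Bhat q θ)) := by
    rw [depthSpan, Submodule.span_le]
    rintro _ ⟨m', ⟨h1, h2⟩, rfl⟩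
    refine IH _ ?_ m' rfl
    have := depth_le m'
    rw [h1] at this ⊢
    omega
  have h3 := Submodule.sub_mem _ (Submodule.subset_span (Set.mem_range_self x)) (hle h)
  rw [sub_sub_cancel] at h3
  exact (Submodule.smul_mem_iff _ hc).mp h3

theorem linearIndependent_Bhat (hn : 1 ≤ n) (hq : q ≠ 0) (hd : ∀ i, θ i i = 1)
    (hθ : ∀ i j, θ i j * θ j i = 1) : LinearIndependent ℂ (Bhat q θ) := by
  set b := (Module.Basis.mk
    (QMat.linearIndependent_monomial hq hd hθ (nodup_blockList (n := n)) mem_blockList)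
    (QMat.span_monomial hq hd hθ nodup_blockList mem_blockList).ge).reindex
      (reducedEquiv hn).symm with hb
  have hbx : ∀ x, b x = monomial (QMat.V q θ) (blockList n) (reducedEquiv hn x) := fun x => by
    simp [hb]
  refine linearIndependent_of_graded_span b (fun x => degree (reducedEquiv hn x)) (fun e => ?_) _
    (fun x => ?_) (span_Bhat hn hq hd hθ)
  · exact (finite_degree e).preimage (reducedEquiv hn).injective.injOn
  · obtain ⟨c, -, h⟩ := Bhat_sub_mem hn hq hd hθ x
    rw [← sub_add_cancel (Bhat q θ x) (c • _)]
    have him : b '' {y | degree (reducedEquiv hn y) = degree (reducedEquiv hn x)} =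
        monomial (QMat.V q θ) (blockList n) '' {m | degree m = degree (reducedEquiv hn x)} := by
      ext z
      constructor
      · rintro ⟨y, hy, rfl⟩
        exact ⟨_, hy, (hbx y).symm⟩
      · rintro ⟨m, hm, rfl⟩
        exact ⟨(reducedEquiv hn).symm m, by simpa using hm, by rw [hbx, Equiv.apply_symm_apply]⟩
    rw [him]
    refine add_mem ?_ (Submodule.smul_mem _ c (Submodule.subset_span ⟨_, rfl, rfl⟩))
    exact Submodule.span_mono (Set.image_mono fun m hm => hm.1) h

end Bhat

/-! ### Localization at the determinant -/

section Regular

variable {n : ℕ} {q : ℝ} {θ : Matrix (Fin n) (Fin n) ℂ}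

theorem scalarCommute_qDet_blockProduct (hq : q ≠ 0) (hd : ∀ i, θ i i = 1)
    (hθ : ∀ i j, θ i j * θ j i = 1) (m : Fin n × Fin n → ℕ) :
    ScalarCommute (qDet q θ (QMat.V q θ)) (blockProduct (QMat.V q θ) m) := by
  rw [blockProduct_eq, ← word_sortedWord]
  exact .word_right fun p _ =>
    ((QMat.isQuantum hq hd hθ).scalarCommute_qDet hq hd hθ p.1 p.2).symm

theorem Bhat_mul_qDet (x : ReducedExponents n × ℕ) :
    Bhat q θ x * qDet q θ (QMat.V q θ) = Bhat q θ (x.1, x.2 + 1) := by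
  rw [Bhat, Bhat, mul_assoc, pow_succ]

theorem linearIndependent_Bhat_succ (hn : 1 ≤ n) (hq : q ≠ 0) (hd : ∀ i, θ i i = 1)
    (hθ : ∀ i j, θ i j * θ j i = 1) :
    LinearIndependent ℂ fun x : ReducedExponents n × ℕ => Bhat q θ (x.1, x.2 + 1) :=
  (linearIndependent_Bhat hn hq hd hθ).comp (fun x : ReducedExponents n × ℕ => (x.1, x.2 + 1))
    fun x y h => by simpa [Prod.ext_iff] using h

/-- Multiplication by the determinant on the right shifts the basis `B̂`. -/
theorem mul_qDet_eq_zero (hn : 1 ≤ n) (hq : q ≠ 0) (hd : ∀ i, θ i i = 1)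
    (hθ : ∀ i j, θ i j * θ j i = 1) (x : QMat n q θ) (h : x * qDet q θ (QMat.V q θ) = 0) :
    x = 0 := by
  have hinj : Function.Injective (LinearMap.mulRight ℂ (qDet q θ (QMat.V q θ))) := by
    refine LinearMap.injective_of_linearIndependent (v := Bhat q θ) (span_Bhat hn hq hd hθ) ?_
    have e : LinearMap.mulRight ℂ (qDet q θ (QMat.V q θ)) ∘ Bhat q θ =
        fun x => Bhat q θ (x.1, x.2 + 1) := funext Bhat_mul_qDet
    rw [e]
    exact linearIndependent_Bhat_succ hn hq hd hθ
  exact hinj (by simpa using h)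

/-- Multiplication by the determinant on the left shifts the basis `B̂` up to nonzero scalars. -/
theorem qDet_mul_eq_zero (hn : 1 ≤ n) (hq : q ≠ 0) (hd : ∀ i, θ i i = 1)
    (hθ : ∀ i j, θ i j * θ j i = 1) (x : QMat n q θ) (h : qDet q θ (QMat.V q θ) * x = 0) :
    x = 0 := by
  choose c hc hcm using scalarCommute_qDet_blockProduct (n := n) hq hd hθ
  have hinj : Function.Injective (LinearMap.mulLeft ℂ (qDet q θ (QMat.V q θ))) := by
    refine LinearMap.injective_of_linearIndependent (v := Bhat q θ) (span_Bhat hn hq hd hθ) ?_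
    have e : LinearMap.mulLeft ℂ (qDet q θ (QMat.V q θ)) ∘ Bhat q θ =
        (fun x : ReducedExponents n × ℕ => Units.mk0 (c x.1.1) (hc x.1.1)) • fun x => Bhat q θ (x.1, x.2 + 1) := by
      ext x
      rw [Function.comp_apply, LinearMap.mulLeft_apply, Bhat, ← mul_assoc, hcm, smul_mul_assoc,
        mul_assoc, ← pow_succ']
      rfl
    rw [e]
    exact (linearIndependent_Bhat_succ hn hq hd hθ).units_smul _
  exact hinj (by simpa using h)

/-- The powers of the quantum determinant satisfy the left Ore condition, as they commute with words
up to scalars. -/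
theorem exists_qDet_pow_mul_eq (hq : q ≠ 0) (hd : ∀ i, θ i i = 1)
    (hθ : ∀ i j, θ i j * θ j i = 1) (k : ℕ) (x : QMat n q θ) :
    ∃ y, y * qDet q θ (QMat.V q θ) ^ k = qDet q θ (QMat.V q θ) ^ k * x := by
  have hx : x ∈ Submodule.span ℂ (Set.range (word (QMat.V q θ))) := by
    rw [QMat.span_word]; trivial
  induction hx using Submodule.span_induction with
  | mem x hx =>
    obtain ⟨l, rfl⟩ := hx
    obtain ⟨c, -, h⟩ := (ScalarCommute.word_right (l := l) fun p _ =>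
      ((QMat.isQuantum hq hd hθ).scalarCommute_qDet hq hd hθ p.1 p.2).symm).symm.pow_right k |>.symm
    exact ⟨c • word (QMat.V q θ) l, by rw [h, smul_mul_assoc]⟩
  | zero => exact ⟨0, by simp⟩
  | add x y _ _ hx hy =>
    obtain ⟨x', hx⟩ := hx
    obtain ⟨y', hy⟩ := hy
    exact ⟨x' + y', by rw [add_mul, mul_add, hx, hy]⟩
  | smul c x _ hx =>
    obtain ⟨x', hx⟩ := hx
    exact ⟨c • x', by rw [smul_mul_assoc, mul_smul_comm, hx]⟩

end Regular

section Localization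

open OreLocalization

/-- A two-sided regular element `d` all of whose powers `d ^ k` satisfy `d ^ k A ⊆ A d ^ k` becomes
invertible in an algebra that contains `A`. -/
theorem exists_injective_algHom_isUnit.{u} {A : Type u} [Ring A] [Algebra ℂ A] (d : A)
    (hr : ∀ x, x * d = 0 → x = 0) (hl : ∀ x, d * x = 0 → x = 0)
    (hore : ∀ (k : ℕ) (x : A), ∃ y, y * d ^ k = d ^ k * x) :
    ∃ (B : Type u) (_ : Ring B) (_ : Algebra ℂ B) (f : A →ₐ[ℂ] B),
      Function.Injective f ∧ IsUnit (f d) := by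
  have hr' : ∀ (k : ℕ) (x : A), x * d ^ k = 0 → x = 0 := fun k => by
    induction k with
    | zero => intro x hx; simpa using hx
    | succ k ih => intro x hx; exact ih x (hr _ (by rwa [mul_assoc, ← pow_succ]))
  have hl' : ∀ (k : ℕ) (x : A), d ^ k * x = 0 → x = 0 := fun k => by
    induction k with
    | zero => intro x hx; simpa using hx
    | succ k ih => intro x hx; exact ih x (hl _ (by rwa [← mul_assoc, ← pow_succ']))
  let S : Submonoid A := Submonoid.powers d
  have hS : ∀ (x : A) (s : S), ∃ y, s * x = y * s := by
    rintro x ⟨_, k, rfl⟩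
    obtain ⟨y, hy⟩ := hore k x
    exact ⟨y, hy.symm⟩
  choose num hnum using hS
  let : OreSet S :=
    { ore_right_cancel := by
        rintro x y ⟨_, k, rfl⟩ h
        refine ⟨1, ?_⟩
        rw [sub_eq_zero.mp (hr' k (x - y) (by rw [sub_mul]; exact sub_eq_zero.mpr h))]
      oreNum := num
      oreDenom := fun _ s => s
      ore_eq := hnum }
  refine ⟨OreLocalization S A, inferInstance, inferInstance,
    { numeratorRingHom (R := A) (S := S) with commutes' := fun _ => rfl }, ?_, ?_⟩
  · refine numeratorHom_inj (S := S) ?_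
    rintro _ ⟨k, rfl⟩
    exact hl' k
  · exact (numeratorUnit (⟨d, Submonoid.mem_powers d⟩ : S)).isUnit

end Localization

section Unitary

variable {n : ℕ} {q : ℝ} {θ : Matrix (Fin n) (Fin n) ℂ}

/-- The defining relation between the generators and `D⁻¹` follows from the commutation of the
generators with the quantum determinant. -/
theorem IsQuantum.mul_inv_qDet {B : Type*} [Ring B] [Algebra ℂ B] (hq : q ≠ 0)
    (hd : ∀ i, θ i i = 1) (hθ : ∀ i j, θ i j * θ j i = 1) {X : Fin n → Fin n → B}
    (hX : IsQuantum (q : ℂ) θ θ X) (u : Bˣ) (hu : (u : B) = qDet q θ X) (i k : Fin n) :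
    X i k * ↑u⁻¹ = ((∏ a : Fin n with a ≠ k, θ k a) / (∏ a : Fin n with a ≠ i, θ i a)) •
      (↑u⁻¹ * X i k) := by
  have hf : ∀ k, ∏ a : Fin n with a ≠ k, θ k a = ∏ a, θ k a := fun k => by
    rw [prod_filter]
    refine prod_congr rfl fun a _ => ?_
    split_ifs with h
    · rfl
    · rw [not_not.mp h, hd]
  have hi : ∀ k, (∏ a, θ k a) * ∏ a, θ a k = 1 := fun k => by
    rw [← prod_mul_distrib]
    exact prod_eq_one fun a _ => hθ k a
  have h := congrArg (fun x => (↑u⁻¹ : B) * x * ↑u⁻¹) (hX.mul_qDet hq hd hθ i k)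
  simp only [← hu, mul_smul_comm, smul_mul_assoc] at h
  rw [show (↑u⁻¹ : B) * (X i k * u) * ↑u⁻¹ = ↑u⁻¹ * X i k by simp [mul_assoc],
    show (↑u⁻¹ : B) * (u * X i k) * ↑u⁻¹ = X i k * ↑u⁻¹ by simp [← mul_assoc]] at h
  have h2 := congrArg (fun x => (∏ a, θ k a) • x) h
  simp only [smul_smul, hi, one_smul] at h2
  rw [← h2, hf, hf, div_eq_mul_inv, eq_inv_of_mul_eq_one_right (hi i)]

/-- The homomorphism out of `ℂ[U_{q,Θ}(n)]` given by a quantum matrix with invertible quantum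
determinant. -/
noncomputable def QUnitary.lift {B : Type*} [Ring B] [Algebra ℂ B] (hq : q ≠ 0)
    (hd : ∀ i, θ i i = 1) (hθ : ∀ i j, θ i j * θ j i = 1) (X : Fin n → Fin n → B)
    (hX : IsQuantum (q : ℂ) θ θ X) (u : Bˣ) (hu : (u : B) = qDet q θ X) :
    QUnitary n q θ →ₐ[ℂ] B :=
  RingQuot.liftAlgHom ℂ
    ⟨FreeAlgebra.lift ℂ fun p => p.elim (↑u⁻¹ : B) fun p => X p.1 p.2, fun _ _ h => by
      cases h with
      | mat h =>
        refine hX.matrixRel hq hd ?_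
        simpa [freeV'] using
          h.map (FreeAlgebra.lift ℂ fun p => p.elim (↑u⁻¹ : B) fun p => X p.1 p.2)
      | comm i k => simpa [freeV', freeDinv] using hX.mul_inv_qDet hq hd hθ u hu i k
      | det_mul_inv => simp [map_qDet, freeV', freeDinv, ← hu]
      | inv_mul_det => simp [map_qDet, freeV', freeDinv, ← hu]⟩

theorem QUnitary.lift_V {B : Type*} [Ring B] [Algebra ℂ B] (hq : q ≠ 0)
    (hd : ∀ i, θ i i = 1) (hθ : ∀ i j, θ i j * θ j i = 1) (X : Fin n → Fin n → B)
    (hX : IsQuantum (q : ℂ) θ θ X) (u : Bˣ) (hu : (u : B) = qDet q θ X) (i j : Fin n) :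
    QUnitary.lift hq hd hθ X hX u hu (QUnitary.V q θ i j) = X i j := by
  simp [QUnitary.lift, QUnitary.V, freeV']

theorem QUnitary.isQuantum (hq : q ≠ 0) (hd : ∀ i, θ i i = 1) (hθ : ∀ i j, θ i j * θ j i = 1) :
    IsQuantum (q : ℂ) θ θ (QUnitary.V q θ) :=
  .of_matrixRel hq hd hθ fun _ _ h =>
    h.eq_of_map (RingQuot.mkAlgHom ℂ (UnitaryRel q θ)) fun _ _ h =>
      RingQuot.mkAlgHom_rel ℂ (.mat h)

/-- The canonical homomorphism `𝒜_{q,Θ}(n) → ℂ[U_{q,Θ}(n)]`. -/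
noncomputable def QMat.toQUnitary (hq : q ≠ 0) (hd : ∀ i, θ i i = 1)
    (hθ : ∀ i j, θ i j * θ j i = 1) : QMat n q θ →ₐ[ℂ] QUnitary n q θ :=
  QMat.lift hq hd _ (QUnitary.isQuantum hq hd hθ)

theorem QMat.toQUnitary_V (hq : q ≠ 0) (hd : ∀ i, θ i i = 1)
    (hθ : ∀ i j, θ i j * θ j i = 1) (i j : Fin n) :
    QMat.toQUnitary hq hd hθ (QMat.V q θ i j) = QUnitary.V q θ i j :=
  QMat.lift_V hq hd _ _ i j

/-- The canonical homomorphism is injective, because it factors the embedding of `𝒜_{q,Θ}(n)` into an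
algebra in which the quantum determinant is invertible. -/
theorem QMat.toQUnitary_injective (hn : 1 ≤ n) (hq : q ≠ 0) (hd : ∀ i, θ i i = 1)
    (hθ : ∀ i j, θ i j * θ j i = 1) :
    Function.Injective (QMat.toQUnitary hq hd hθ : QMat n q θ →ₐ[ℂ] QUnitary n q θ) := by
  obtain ⟨B, _, _, f, hf, u, hu⟩ := exists_injective_algHom_isUnit (qDet q θ (QMat.V q θ))
    (mul_qDet_eq_zero hn hq hd hθ) (qDet_mul_eq_zero hn hq hd hθ) (exists_qDet_pow_mul_eq hq hd hθ)
  rw [map_qDet] at hu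
  have hX := (QMat.isQuantum hq hd hθ).map f
  have h : (QUnitary.lift hq hd hθ _ hX u hu).comp (QMat.toQUnitary hq hd hθ) = f := by
    refine RingQuot.ringQuot_ext' ℂ _ _ (FreeAlgebra.hom_ext (funext fun p => ?_))
    have := QUnitary.lift_V hq hd hθ _ hX u hu p.1 p.2
    rw [← QMat.toQUnitary_V hq hd hθ] at this
    exact this
  refine Function.Injective.of_comp (f := QUnitary.lift hq hd hθ _ hX u hu) ?_
  rw [← AlgHom.coe_comp, h]
  exact hf

theorem QMat.toQUnitary_Bhat (hq : q ≠ 0) (hd : ∀ i, θ i i = 1)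
    (hθ : ∀ i j, θ i j * θ j i = 1) (x : ReducedExponents n × ℕ) :
    QMat.toQUnitary hq hd hθ (Bhat q θ x) = Btilde q θ (x.1, (x.2 : ℤ)) := by
  rw [Bhat, Btilde, map_mul, map_pow, map_qDet, blockProduct_eq, map_monomial, blockProduct_eq]
  simp only [QMat.toQUnitary_V, zpow_natCast, Units.val_pow_eq_pow_val]
  rfl

theorem Btilde_mul_detUnit_zpow (x : ReducedExponents n × ℤ) (k : ℤ) :
    Btilde q θ x * ((QUnitary.detUnit q θ ^ k : (QUnitary n q θ)ˣ) : QUnitary n q θ) =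
      Btilde q θ (x.1, x.2 + k) := by
  rw [Btilde, Btilde, mul_assoc, ← Units.val_mul, ← zpow_add]

/-- A relation between elements of `B̃` becomes one between elements of `B̂` after multiplication
by a high power of the determinant. -/
theorem linearIndependent_Btilde (hn : 1 ≤ n) (hq : q ≠ 0) (hd : ∀ i, θ i i = 1)
    (hθ : ∀ i j, θ i j * θ j i = 1) : LinearIndependent ℂ (Btilde q θ) := by
  have hnat : LinearIndependent ℂ fun x : ReducedExponents n × ℕ =>
      Btilde q θ (x.1, (x.2 : ℤ)) := by
    have e : (QMat.toQUnitary hq hd hθ).toLinearMap ∘ Bhat q θ =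
        fun x => Btilde q θ (x.1, (x.2 : ℤ)) := funext (QMat.toQUnitary_Bhat hq hd hθ)
    rw [← e]
    exact (linearIndependent_Bhat hn hq hd hθ).map' (QMat.toQUnitary hq hd hθ).toLinearMap
      (LinearMap.ker_eq_bot_of_injective (QMat.toQUnitary_injective hn hq hd hθ))
  rw [linearIndependent_iff']
  intro s g hg x hx
  -- an exponent that makes all powers of the determinant in the relation nonnegative
  set N : ℕ := ∑ y ∈ s, y.2.natAbs with hN
  have hpos : ∀ y ∈ s, 0 ≤ y.2 + N := fun y hy => by
    have : y.2.natAbs ≤ N := single_le_sum (f := fun y : ReducedExponents n × ℤ => y.2.natAbs)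
      (fun _ _ => Nat.zero_le _) hy
    omega
  have hinj : Function.Injective fun y : s => (y.1.1, (y.1.2 + N).toNat) := fun y z h => by
    have h1 := hpos y y.2
    have h2 := hpos z z.2
    simp only [Prod.mk.injEq] at h
    exact Subtype.ext (Prod.ext h.1 (by omega))
  have h1 := linearIndependent_iff'.mp (hnat.comp _ hinj) univ (fun y => g y) (by
    have h2 := congrArg
      (· * ((QUnitary.detUnit q θ ^ (N : ℤ) : (QUnitary n q θ)ˣ) : QUnitary n q θ)) hg
    simp only [sum_mul, smul_mul_assoc, Btilde_mul_detUnit_zpow, zero_mul] at h2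
    rw [← h2, ← sum_coe_sort s]
    refine sum_congr rfl fun y _ => ?_
    simp only [Function.comp_apply, Int.toNat_of_nonneg (hpos y y.2)])
  exact h1 ⟨x, hx⟩ (mem_univ _)

/-- The span of `B̃` contains `1` and is closed under right multiplication by the generators, since
these commute with all powers of the determinant up to scalars. -/
theorem span_Btilde (hn : 1 ≤ n) (hq : q ≠ 0) (hd : ∀ i, θ i i = 1)
    (hθ : ∀ i j, θ i j * θ j i = 1) : Submodule.span ℂ (Set.range (Btilde q θ)) = ⊤ := by
  set W := Submodule.span ℂ (Set.range (Btilde q θ)) with hW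
  set D := QUnitary.detUnit q θ
  -- the canonical map takes its values in the span
  have hφ : ∀ x, QMat.toQUnitary hq hd hθ x ∈ W := fun x => by
    have hx : x ∈ Submodule.span ℂ (Set.range (Bhat q θ)) := by
      rw [span_Bhat hn hq hd hθ]; trivial
    induction hx using Submodule.span_induction with
    | mem x hx =>
      obtain ⟨y, rfl⟩ := hx
      rw [QMat.toQUnitary_Bhat]
      exact Submodule.subset_span ⟨_, rfl⟩
    | zero => simp
    | add x y _ _ hx hy => rw [map_add]; exact add_mem hx hy
    | smul c x _ hx => rw [map_smul]; exact Submodule.smul_mem _ _ hx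
  have hD : ∀ (k : ℤ) (x), x ∈ W → x * ((D ^ k : (QUnitary n q θ)ˣ) : QUnitary n q θ) ∈ W :=
    fun k x hx => by
      induction hx using Submodule.span_induction with
      | mem x hx =>
        obtain ⟨y, rfl⟩ := hx
        rw [Btilde_mul_detUnit_zpow]
        exact Submodule.subset_span ⟨_, rfl⟩
      | zero => simp
      | add x y _ _ hx hy => rw [add_mul]; exact add_mem hx hy
      | smul c x _ hx => rw [smul_mul_assoc]; exact Submodule.smul_mem _ _ hx
  -- commutation with positive powers of the determinant yields that with negative ones
  have hcomm : ∀ i j (k : ℤ), ScalarCommute ((D ^ k : (QUnitary n q θ)ˣ) : QUnitary n q θ)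
      (QUnitary.V q θ i j) := fun i j k => by
    have h0 := (QUnitary.isQuantum hq hd hθ).scalarCommute_qDet hq hd hθ i j
    obtain ⟨k, rfl | rfl⟩ := k.eq_nat_or_neg
    · rw [zpow_natCast, Units.val_pow_eq_pow_val]
      exact (h0.pow_right k).symm
    · obtain ⟨c, hc, h⟩ := h0.pow_right k
      refine ⟨c, hc, ?_⟩
      rw [zpow_neg, zpow_natCast, Units.inv_mul_eq_iff_eq_mul, mul_smul_comm, ← mul_assoc,
        ← smul_mul_assoc, Units.eq_mul_inv_iff_mul_eq, Units.val_pow_eq_pow_val]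
      exact h
  have hV : ∀ i j x, x ∈ W → x * QUnitary.V q θ i j ∈ W := fun i j x hx => by
    induction hx using Submodule.span_induction with
    | mem x hx =>
      obtain ⟨y, rfl⟩ := hx
      obtain ⟨c, -, h⟩ := hcomm i j y.2
      rw [Btilde, mul_assoc, h, mul_smul_comm, ← mul_assoc]
      refine Submodule.smul_mem _ _ (hD _ _ ?_)
      have := hφ (blockProduct (QMat.V q θ) y.1.1 * QMat.V q θ i j)
      simpa only [map_mul, blockProduct_eq, map_monomial, QMat.toQUnitary_V] using this
    | zero => simp
    | add x y _ _ hx hy => rw [add_mul]; exact add_mem hx hy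
    | smul c x _ hx => rw [smul_mul_assoc]; exact Submodule.smul_mem _ _ hx
  rw [eq_top_iff]
  rintro x -
  obtain ⟨x, rfl⟩ := RingQuot.mkAlgHom_surjective ℂ (UnitaryRel q θ) x
  suffices H : ∀ y ∈ W, y * RingQuot.mkAlgHom ℂ (UnitaryRel q θ) x ∈ W by
    simpa using H 1 (by simpa using hφ 1)
  induction x using FreeAlgebra.induction with
  | grade0 c =>
    intro y hy
    rw [AlgHom.commutes, ← Algebra.commutes, ← Algebra.smul_def]
    exact Submodule.smul_mem _ _ hy
  | grade1 p =>
    intro y hy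
    cases p with
    | none =>
      have := hD (-1) y hy
      rw [zpow_neg_one] at this
      exact this
    | some p => exact hV p.1 p.2 y hy
  | mul a b ha hb => intro y hy; rw [map_mul, ← mul_assoc]; exact hb _ (ha _ hy)
  | add a b ha hb => intro y hy; rw [map_add, mul_add]; exact add_mem (ha _ hy) (hb _ hy)

end Unitary

end QuantumUnitary

theorem mainTheorem4 (n : ℕ) (hn : 1 ≤ n) (q : ℝ) (hq : 0 < q)
    (θ : Matrix (Fin n) (Fin n) ℂ)
    (hθ_diag : ∀ i, θ i i = 1)
    (hθ_norm : ∀ i j, ‖θ i j‖ = 1)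
    (hθ_conj : ∀ i j, (starRingEnd ℂ) (θ j i) = θ i j) :
    -- the monomials ordered by `≤₀` form a basis of `𝒜_{q,Θ}(n)`
    (LinearIndependent ℂ (fun m : Fin n × Fin n → ℕ =>
        QuantumUnitary.orderedMonomial (QuantumUnitary.QMat.V q θ) m) ∧
      Submodule.span ℂ (Set.range (fun m : Fin n × Fin n → ℕ =>
        QuantumUnitary.orderedMonomial (QuantumUnitary.QMat.V q θ) m)) = ⊤) ∧
    -- `B̂` is a basis of `𝒜_{q,Θ}(n)`
    (LinearIndependent ℂ (QuantumUnitary.Bhat q θ) ∧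
      Submodule.span ℂ (Set.range (QuantumUnitary.Bhat q θ)) = ⊤) ∧
    -- `B̃` is a basis of `ℂ[U_{q,Θ}(n)]`
    (LinearIndependent ℂ (QuantumUnitary.Btilde q θ) ∧
      Submodule.span ℂ (Set.range (QuantumUnitary.Btilde q θ)) = ⊤) := by
  have hq' := hq.ne'
  have hθ : ∀ i j, θ i j * θ j i = 1 := fun i j => by
    rw [← hθ_conj j i, Complex.mul_conj, Complex.normSq_eq_norm_sq, hθ_norm]
    norm_num
  have hL : ((Finset.univ : Finset (Fin n × Fin n)).sort QuantumUnitary.le0).Nodup :=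
    Finset.sort_nodup _ _
  have hL' : ∀ p, p ∈ (Finset.univ : Finset (Fin n × Fin n)).sort QuantumUnitary.le0 :=
    fun p => (Finset.mem_sort _).mpr (Finset.mem_univ p)
  exact ⟨⟨QuantumUnitary.QMat.linearIndependent_monomial hq' hθ_diag hθ hL hL',
      QuantumUnitary.QMat.span_monomial hq' hθ_diag hθ hL hL'⟩,
    ⟨QuantumUnitary.linearIndependent_Bhat hn hq' hθ_diag hθ,
      QuantumUnitary.span_Bhat hn hq' hθ_diag hθ⟩,
    QuantumUnitary.linearIndependent_Btilde hn hq' hθ_diag hθ,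
    QuantumUnitary.span_Btilde hn hq' hθ_diag hθ⟩
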